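/- Work over $\mathbb{C}$, and let $\kappa=81+36\sqrt5$. Let $C$ be the smooth projective curve with affine equation $$-\sqrt5\,y^2=x(x-1)(x-\kappa)(x-2\kappa+1)(x-2\kappa);$$ its points are the points of this affine curve together with one point at infinity, and it has genus $2$. Let $E$ be the elliptic curve $y^2=x^3-x$. Then there is a morphism $f:C\to E$ of degree $5$, given by $$f(x,y)=(g(x),\,h(x)\,y),$$ where $$g(x)=\frac{x^5+a_4x^4+a_3x^3+a_2x^2+a_1x+a_0}{b_2x^2+b_1x},\qquad h(x)=\frac{x^6+c_5x^5+c_4x^4+c_3x^3+c_2x^2+c_1x+c_0}{d\,x^2(x-2\kappa)^2}$$ and $$\begin{aligned} a_4&=-45(9+4\sqrt5), & a_3&=660(161+72\sqrt5), & a_2&=-3240(2889+1292\sqrt5),\\ a_1&=1980(51841+23184\sqrt5), & a_0&=-324(930249+416020\sqrt5),\\ b_2&=-100\sqrt5(2889+1292\sqrt5), & b_1&=1800\sqrt5(51841+23184\sqrt5),\\ c_5&=-54(9+4\sqrt5), & c_4&=1030(161+72\sqrt5), & c_3&=-7920(2889+1292\sqrt5),\\ c_2&=18780(51841+23184\sqrt5),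 & c_1&=216(930249+416020\sqrt5), & c_0&=-1944(16692641+7465176\sqrt5),\\ d&=1000\sqrt5(219602+98209\sqrt5). \end{aligned}$$ The morphism $f$ is branched only above the point at infinity of $E$, and there is a single ramification point above it, a triple point: $f$ maps the point at infinity of $C$ to the point at infinity of $E$ with ramification index $3$, and $f$ is unramified at every other point of $C$. -/

import Mathlib

open Polynomial

/-! ### Smooth projective curves through their function fields

A smooth projective curve over an algebraically closed field `k` is given by its function field
`K`: its closed points are the valuation rings of `K` over `k`, its regular differentials are the
elements of `Ω[K⁄k]` that are regular at every point, and a non-constant morphism of curves is a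
finite embedding of function fields in the opposite direction. -/

/-- A (closed) point of the smooth projective curve over `k` with function field `K`: a nontrivial
valuation ring of `K` containing `k`, the ring of the functions that are regular at the point.
(When `K` is a function field of one variable, all these rings are discrete valuation rings.) -/
structure CurvePoint (k K : Type*) [Field k] [Field K] [Algebra k K] where
  ring : ValuationSubring K
  algebraMap_mem : ∀ c : k, algebraMap k K c ∈ ring
  ne_top : ring ≠ ⊤

namespace CurvePoint

variable {k K : Type*} [Field k] [Field K] [Algebra k K]

/-- The rational function `u` is regular at `P` and takes the value `c` there: `u - c` lies in the
maximal ideal of the local ring at `P`. -/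
def HasValue (P : CurvePoint k K) (u : K) (c : k) : Prop :=
  P.ring.valuation (u - algebraMap k K c) < 1

/-- The rational function `u` has a pole at `P`. -/
def HasPole (P : CurvePoint k K) (u : K) : Prop := u ∉ P.ring

/-- The rational differentials that are regular at `P`: the submodule generated over the local
ring `𝒪_P` by the differentials `dt`, `t ∈ 𝒪_P`. -/
noncomputable def regularDifferentials (P : CurvePoint k K) : Submodule k (Ω[K⁄k]) :=
  Submodule.span k {ω | ∃ u ∈ P.ring, ∃ t ∈ P.ring, ω = u • KaehlerDifferential.D k K t}

end CurvePoint

/-- The genus of the smooth projective curve over `k` with function field `K`: the dimension of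
the space of the everywhere regular differentials. -/
noncomputable def curveGenus (k K : Type*) [Field k] [Field K] [Algebra k K] : ℕ :=
  Module.finrank k (⨅ P : CurvePoint k K, P.regularDifferentials : Submodule k (Ω[K⁄k]))

/-- A non-constant morphism over `k` from the smooth projective curve with function field `L` to
the one with function field `K`, given by the pullback of rational functions. -/
structure CurveMorphism (k L K : Type*) [Field k] [Field L] [Field K] [Algebra k L]
    [Algebra k K] where
  pullback : K →ₐ[k] L
  finite : pullback.toRingHom.Finite

namespace CurveMorphism

variable {k L K : Type*} [Field k] [Field L] [Field K] [Algebra k L] [Algebra k K]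

/-- The degree of a morphism of curves: the degree of the extension of function fields. -/
noncomputable def degree (f : CurveMorphism k L K) : ℕ :=
  Module.finrank f.pullback.fieldRange L

theorem comap_ne_top (f : CurveMorphism k L K) (P : CurvePoint k L) :
    P.ring.comap f.pullback.toRingHom ≠ ⊤ := by
  intro h
  refine P.ne_top (top_unique fun z _ => ?_)
  obtain ⟨p, hp, hz⟩ := f.finite.to_isIntegral z
  have hK : ∀ c : K, f.pullback.toRingHom c ∈ P.ring := fun c => by
    have : c ∈ P.ring.comap f.pullback.toRingHom := h ▸ ValuationSubring.mem_top c
    exact this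
  let j : K →+* P.ring := f.pullback.toRingHom.codRestrict P.ring hK
  have hint : IsIntegral P.ring z := by
    refine ⟨p.map j, hp.map j, ?_⟩
    rw [eval₂_map]
    exact hz
  obtain ⟨w, rfl⟩ := IsIntegrallyClosed.isIntegral_iff.mp hint
  exact w.2

/-- The image of a point under a morphism of curves: a rational function is regular at `f P` if and
only if its pullback is regular at `P`. -/
noncomputable def map (f : CurveMorphism k L K) (P : CurvePoint k L) : CurvePoint k K where
  ring := P.ring.comap f.pullback.toRingHom
  algebraMap_mem c := by
    have h := P.algebraMap_mem c
    rw [← f.pullback.commutes] at h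
    exact h
  ne_top := f.comap_ne_top P

/-- The homomorphism of local rings from `𝒪_{f(P)}` to `𝒪_P`. -/
noncomputable def localRingHom (f : CurveMorphism k L K) (P : CurvePoint k L) :
    (f.map P).ring →+* P.ring :=
  (f.pullback.toRingHom.comp (f.map P).ring.subtype).codRestrict P.ring fun u => u.2

/-- The ramification index of `f` at `P`: the largest `e` such that the pullback of the maximal
ideal of `𝒪_{f(P)}` lies in the `e`-th power of the maximal ideal of `𝒪_P`. -/
noncomputable def ramificationIndex (f : CurveMorphism k L K) (P : CurvePoint k L) : ℕ :=
  sSup {e : ℕ | (IsLocalRing.maximalIdeal (f.map P).ring).map (f.localRingHom P) ≤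
    IsLocalRing.maximalIdeal P.ring ^ e}

end CurveMorphism

/-! ### The curves `C` and `E` -/

/-- The square root of five in `ℂ`. -/
noncomputable def sqrt5 : ℂ := ((√5 : ℝ) : ℂ)

/-- `κ = 81 + 36 √5`. -/
noncomputable def kappa : ℂ := 81 + 36 * sqrt5

/-- The quintic `x (x - 1) (x - κ) (x - 2κ + 1) (x - 2κ)`. -/
noncomputable def quinticC : ℂ[X] :=
  X * (X - C 1) * (X - C kappa) * (X - C (2 * kappa - 1)) * (X - C (2 * kappa))

/-- The polynomial `-√5 Y² - x (x - 1) (x - κ) (x - 2κ + 1) (x - 2κ)` that defines `C`. -/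
noncomputable def polynomialC : ℂ[X][X] := C (C (-sqrt5)) * X ^ 2 - C quinticC

theorem sqrt5_ne_zero : sqrt5 ≠ 0 := by
  simp [sqrt5]

theorem natDegree_quinticC : quinticC.natDegree = 5 := by
  unfold quinticC
  compute_degree!

theorem irreducible_polynomialC : Irreducible polynomialC := by
  have hs : -sqrt5 ≠ 0 := neg_ne_zero.mpr sqrt5_ne_zero
  have hu : IsUnit (C (C (-sqrt5)) : ℂ[X][X]) :=
    isUnit_C.mpr (isUnit_C.mpr (isUnit_iff_ne_zero.mpr hs))
  have heq : polynomialC = C (C (-sqrt5)) * (X ^ 2 - C (C (-sqrt5)⁻¹ * quinticC)) := by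
    rw [polynomialC, mul_sub, ← C_mul, ← mul_assoc, ← C_mul, mul_inv_cancel₀ hs, C_1, one_mul]
  rw [heq, irreducible_isUnit_mul hu]
  have hm : (X ^ 2 - C (C (-sqrt5)⁻¹ * quinticC) : ℂ[X][X]).Monic :=
    monic_X_pow_sub_C _ two_ne_zero
  have hd : (X ^ 2 - C (C (-sqrt5)⁻¹ * quinticC) : ℂ[X][X]).natDegree = 2 := natDegree_X_pow_sub_C
  rw [hm.irreducible_iff_roots_eq_zero_of_degree_le_three (by omega) (by omega)]
  refine Multiset.eq_zero_of_forall_notMem fun r hr => ?_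
  have hr' := (mem_roots'.mp hr).2
  rw [IsRoot.def, eval_sub, eval_pow, eval_X, eval_C, sub_eq_zero] at hr'
  have h5 := congrArg natDegree hr'
  rw [natDegree_pow, natDegree_C_mul (inv_ne_zero hs), natDegree_quinticC] at h5
  omega

/-- The affine coordinate ring of `C`. -/
abbrev CoordinateRingC : Type := AdjoinRoot polynomialC

instance : IsDomain CoordinateRingC := AdjoinRoot.isDomain_of_prime irreducible_polynomialC.prime

/-- The function field of `C`. -/
abbrev FunctionFieldC : Type := FractionRing CoordinateRingC

/-- The coordinate function `x` on `C`. -/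
noncomputable def xC : FunctionFieldC :=
  algebraMap CoordinateRingC FunctionFieldC (AdjoinRoot.of polynomialC X)

/-- The coordinate function `y` on `C`. -/
noncomputable def yC : FunctionFieldC :=
  algebraMap CoordinateRingC FunctionFieldC (AdjoinRoot.root polynomialC)

/-- The curve `E : y² = x³ - x`. -/
noncomputable def curveE : WeierstrassCurve.Affine ℂ := ⟨0, 0, 0, -1, 0⟩

/-- The coordinate function `x` on `E`. -/
noncomputable def xE : curveE.FunctionField :=
  algebraMap curveE.CoordinateRing curveE.FunctionField (AdjoinRoot.of curveE.polynomial X)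

/-- The coordinate function `y` on `E`. -/
noncomputable def yE : curveE.FunctionField :=
  algebraMap curveE.CoordinateRing curveE.FunctionField (AdjoinRoot.root curveE.polynomial)

/-! ### The rational functions `g` and `h` -/

namespace CoverCoeff

noncomputable def a₄ : ℂ := -45 * (9 + 4 * sqrt5)
noncomputable def a₃ : ℂ := 660 * (161 + 72 * sqrt5)
noncomputable def a₂ : ℂ := -3240 * (2889 + 1292 * sqrt5)
noncomputable def a₁ : ℂ := 1980 * (51841 + 23184 * sqrt5)
noncomputable def a₀ : ℂ := -324 * (930249 + 416020 * sqrt5)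
noncomputable def b₂ : ℂ := -100 * sqrt5 * (2889 + 1292 * sqrt5)
noncomputable def b₁ : ℂ := 1800 * sqrt5 * (51841 + 23184 * sqrt5)
noncomputable def c₅ : ℂ := -54 * (9 + 4 * sqrt5)
noncomputable def c₄ : ℂ := 1030 * (161 + 72 * sqrt5)
noncomputable def c₃ : ℂ := -7920 * (2889 + 1292 * sqrt5)
noncomputable def c₂ : ℂ := 18780 * (51841 + 23184 * sqrt5)
noncomputable def c₁ : ℂ := 216 * (930249 + 416020 * sqrt5)
noncomputable def c₀ : ℂ := -1944 * (16692641 + 7465176 * sqrt5)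
noncomputable def d : ℂ := 1000 * sqrt5 * (219602 + 98209 * sqrt5)

end CoverCoeff

open CoverCoeff in
/-- The rational function `g = (x⁵ + a₄ x⁴ + a₃ x³ + a₂ x² + a₁ x + a₀) / (b₂ x² + b₁ x)`,
evaluated at an element of a field extension of `ℂ`. -/
noncomputable def coverG {K : Type*} [Field K] [Algebra ℂ K] (x : K) : K :=
  aeval x (X ^ 5 + C a₄ * X ^ 4 + C a₃ * X ^ 3 + C a₂ * X ^ 2 + C a₁ * X + C a₀) /
    aeval x (C b₂ * X ^ 2 + C b₁ * X)

open CoverCoeff in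
/-- The rational function
`h = (x⁶ + c₅ x⁵ + c₄ x⁴ + c₃ x³ + c₂ x² + c₁ x + c₀) / (d x² (x - 2κ)²)`,
evaluated at an element of a field extension of `ℂ`. -/
noncomputable def coverH {K : Type*} [Field K] [Algebra ℂ K] (x : K) : K :=
  aeval x (X ^ 6 + C c₅ * X ^ 5 + C c₄ * X ^ 4 + C c₃ * X ^ 3 + C c₂ * X ^ 2 + C c₁ * X + C c₀) /
    aeval x (C d * X ^ 2 * (X - C (2 * kappa)) ^ 2)

/-! Put ε = 9 + 4√5, so that κ = 9ε, and x = ε(w + 9). Up to constants the quintic becomes w(w² -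
81)(w² - 80), g becomes w(w² - 75)²/(w² - 81), and the numerator of h becomes (w² - 75)(w⁴ - 110w² +
2025). That f lands on E is then the identity u(u - 75)⁴ - 50000(u - 81)² = (u - 80)(u² - 110u +
2025)² in u = w² (`coverH_sq_mul`).

The ramification is governed by `derivative_mul_sub`: g' is a constant multiple of h. Equivalently,
the pullback of dX/Y is a constant multiple of dx/y, a differential whose only zero is a double one
at infinity; this forces a single triple ramification point. The proof makes this explicit with
local parameters. At infinity x_E and y_E pull back to poles of order 6 and 9, so x_E / y_E acquires
a zero of order 3. At every other point some function on E pulls back to a local parameter: x_E /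
y_E above infinity, y_E where it vanishes, and x_E - g(a) elsewhere.

The degree is found from two towers over ℂ(g): ℂ(x) has degree 5 over it, the function field of E
has degree 2, and the function field of C has degree 2 over ℂ(x) (`finrank_fieldRange`).

Points, local parameters and genus are treated for any y² = Q(x) with Q of odd degree 2m + 1
(`IsDoubleCover`). At a finite point, induction on the vanishing order of the norm p² - q²Q writes
each function as a power of y or x - a up to units (`exists_mul_eq_pow_mul`). At infinity the orders
of p(x) and q(x)y have opposite parity, so they never cancel (`valuation_add_mul`). For the genus,
dx/y generates the regular differentials at every finite point when Q is separable, so a global one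
is (p + qy) dx/y; the condition at infinity leaves q = 0 and deg p < m (`curveGenus_eq`). -/

/-! ### Values, poles and local parameters at a point -/

namespace CurvePoint

variable {k K : Type*} [Field k] [Field K] [Algebra k K] (P : CurvePoint k K)

theorem valuation_algebraMap_le (c : k) : P.ring.valuation (algebraMap k K c) ≤ 1 :=
  (P.ring.valuation_le_one_iff _).mpr (P.algebraMap_mem c)

theorem valuation_algebraMap {c : k} (hc : c ≠ 0) :
    P.ring.valuation (algebraMap k K c) = 1 := by
  refine le_antisymm (P.valuation_algebraMap_le c) ?_
  have h := P.valuation_algebraMap_le c⁻¹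
  rw [map_inv₀, map_inv₀] at h
  exact (inv_le_one₀ (by simp [zero_lt_iff, hc])).mp h

theorem ext_ring {P P' : CurvePoint k K} (h : P.ring = P'.ring) : P = P' := by
  cases P; cases P'; simp_all

variable {P}

theorem hasPole_iff {u : K} : P.HasPole u ↔ 1 < P.ring.valuation u := by
  rw [HasPole, ← P.ring.valuation_le_one_iff, not_le]

theorem hasValue_zero_iff {u : K} : P.HasValue u 0 ↔ P.ring.valuation u < 1 := by
  simp [HasValue]

theorem hasValue_algebraMap (c : k) : P.HasValue (algebraMap k K c) c := by
  simp [HasValue]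

namespace HasValue

variable {u u' : K} {c c' : k}

theorem valuation_le (h : P.HasValue u c) : P.ring.valuation u ≤ 1 := by
  rw [← sub_add_cancel u (algebraMap k K c)]
  exact Valuation.map_add_le _ (le_of_lt h) (P.valuation_algebraMap_le c)

theorem mem (h : P.HasValue u c) : u ∈ P.ring :=
  (P.ring.valuation_le_one_iff _).mp h.valuation_le

theorem valuation_eq_one (h : P.HasValue u c) (hc : c ≠ 0) : P.ring.valuation u = 1 := by
  rw [← P.valuation_algebraMap hc]
  refine Valuation.map_eq_of_sub_lt _ ?_
  rw [P.valuation_algebraMap hc]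
  exact h

theorem add (h : P.HasValue u c) (h' : P.HasValue u' c') : P.HasValue (u + u') (c + c') := by
  rw [HasValue, map_add, add_sub_add_comm]
  exact Valuation.map_add_lt _ h h'

theorem mul (h : P.HasValue u c) (h' : P.HasValue u' c') : P.HasValue (u * u') (c * c') := by
  have e : u * u' - algebraMap k K (c * c') =
      u * (u' - algebraMap k K c') + algebraMap k K c' * (u - algebraMap k K c) := by
    rw [map_mul]; ring
  rw [HasValue, e]
  refine Valuation.map_add_lt _ ?_ ?_ <;> rw [map_mul]
  · exact (mul_le_of_le_one_left' h.valuation_le).trans_lt h'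
  · exact (mul_le_of_le_one_left' (P.valuation_algebraMap_le _)).trans_lt h

theorem neg (h : P.HasValue u c) : P.HasValue (-u) (-c) := by
  have := (hasValue_algebraMap (P := P) (-1)).mul h
  simpa using this

theorem sub (h : P.HasValue u c) (h' : P.HasValue u' c') : P.HasValue (u - u') (c - c') := by
  simpa only [sub_eq_add_neg] using h.add h'.neg

theorem pow (h : P.HasValue u c) (n : ℕ) : P.HasValue (u ^ n) (c ^ n) := by
  induction n with
  | zero => simpa using hasValue_algebraMap (P := P) 1
  | succ n ih => simpa only [pow_succ] using ih.mul h

theorem inv (h : P.HasValue u c) (hc : c ≠ 0) : P.HasValue u⁻¹ c⁻¹ := by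
  have hv := h.valuation_eq_one hc
  have hu : u ≠ 0 := by rintro rfl; simp at hv
  have hc' : algebraMap k K c ≠ 0 := by simpa using hc
  have e : u⁻¹ - algebraMap k K c⁻¹ = -(u - algebraMap k K c) * (u⁻¹ * algebraMap k K c⁻¹) := by
    rw [map_inv₀]; field_simp; ring
  rw [HasValue, e, map_mul, Valuation.map_neg]
  refine (mul_le_of_le_one_right' ?_).trans_lt h
  rw [map_mul, map_inv₀, hv, inv_one, one_mul]
  exact P.valuation_algebraMap_le _

theorem div (h : P.HasValue u c) (h' : P.HasValue u' c') (hc : c' ≠ 0) :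
    P.HasValue (u / u') (c / c') := by
  simpa only [div_eq_mul_inv] using h.mul (h'.inv hc)

theorem aeval (h : P.HasValue u c) (p : k[X]) :
    P.HasValue (Polynomial.aeval u p) (p.eval c) := by
  induction p using Polynomial.induction_on' with
  | add p q hp hq => simpa using hp.add hq
  | monomial n a => simpa [aeval_monomial] using (hasValue_algebraMap a).mul (h.pow n)

theorem unique (h : P.HasValue u c) (h' : P.HasValue u c') : c = c' := by
  by_contra hne
  have := (h.sub h').valuation_eq_one (sub_ne_zero.mpr hne)
  simp at this

end HasValue

theorem mem_of_sq_mem {u : K} (h : u ^ 2 ∈ P.ring) : u ∈ P.ring := by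
  rw [← P.ring.valuation_le_one_iff, map_pow] at h
  rw [← P.ring.valuation_le_one_iff]
  exact (pow_le_one_iff two_ne_zero).mp h

theorem aeval_mem {u : K} (h : u ∈ P.ring) (p : k[X]) : aeval u p ∈ P.ring := by
  induction p using Polynomial.induction_on' with
  | add p q hp hq => simpa using add_mem hp hq
  | monomial n a => simpa [aeval_monomial] using mul_mem (P.algebraMap_mem a) (pow_mem h n)

variable (P) in
/-- `t` is a local parameter at `P`. -/
def IsUniformizer (t : K) : Prop :=
  t ≠ 0 ∧ P.ring.valuation t < 1 ∧
    ∀ r : K, r ≠ 0 → ∃ n : ℤ, P.ring.valuation r = P.ring.valuation t ^ n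

namespace IsUniformizer

variable {t : K}

theorem valuation_le_of_lt_one (ht : P.IsUniformizer t) {r : K} (hr : P.ring.valuation r < 1) :
    P.ring.valuation r ≤ P.ring.valuation t := by
  obtain rfl | h0 := eq_or_ne r 0
  · simp
  obtain ⟨n, hn⟩ := ht.2.2 r h0
  have hpos : 0 < P.ring.valuation t := by simpa [zero_lt_iff] using ht.1
  rw [hn] at hr ⊢
  have hn0 : 0 < n := by
    by_contra hle
    exact absurd hr (not_lt.mpr (one_le_zpow_of_nonpos₀ hpos ht.2.1.le (not_lt.mp hle)))
  calc _ ≤ P.ring.valuation t ^ (1 : ℤ) := zpow_le_zpow_right_of_le_one₀ hpos ht.2.1.le hn0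
    _ = _ := zpow_one _

theorem mem (ht : P.IsUniformizer t) : t ∈ P.ring :=
  (P.ring.valuation_le_one_iff _).mp ht.2.1.le

theorem maximalIdeal_eq (ht : P.IsUniformizer t) :
    IsLocalRing.maximalIdeal P.ring = Ideal.span {⟨t, ht.mem⟩} := by
  ext r
  rw [P.ring.valuation_lt_one_iff, Ideal.mem_span_singleton']
  constructor
  · intro hr
    obtain ⟨a, ha⟩ := (P.ring.valuation_le_iff _ _).mp (ht.valuation_le_of_lt_one hr)
    exact ⟨a, Subtype.ext ha⟩
  · rintro ⟨a, rfl⟩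
    have : P.ring.valuation ((a * ⟨t, ht.mem⟩ : P.ring) : K) =
      P.ring.valuation a * P.ring.valuation t := map_mul _ _ _
    rw [this]
    exact (mul_le_of_le_one_left' (P.ring.valuation_le_one a)).trans_lt ht.2.1

theorem mem_maximalIdeal_pow (ht : P.IsUniformizer t) (e : ℕ) (r : P.ring) :
    r ∈ IsLocalRing.maximalIdeal P.ring ^ e ↔ P.ring.valuation r ≤ P.ring.valuation t ^ e := by
  rw [ht.maximalIdeal_eq, Ideal.span_singleton_pow, Ideal.mem_span_singleton', ← map_pow,
    P.ring.valuation_le_iff]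
  exact exists_congr fun a => Subtype.ext_iff

end IsUniformizer

end CurvePoint

/-! ### Ramification indices through valuations -/

namespace CurveMorphism

variable {k L K : Type*} [Field k] [Field L] [Field K] [Algebra k L] [Algebra k K]
variable (f : CurveMorphism k L K) {P : CurvePoint k L}

theorem mem_map_ring {u : K} : u ∈ (f.map P).ring ↔ f.pullback u ∈ P.ring := Iff.rfl

/-- The two valuations have different value groups, but being a nonunit only involves membership of
the inverse in the ring, which is compatible with pullback. -/
theorem map_valuation_lt_one_iff {u : K} :
    (f.map P).ring.valuation u < 1 ↔ P.ring.valuation (f.pullback u) < 1 := by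
  rw [← ValuationSubring.mem_nonunits_iff, ← ValuationSubring.mem_nonunits_iff,
    ValuationSubring.mem_nonunits_iff_or, ValuationSubring.mem_nonunits_iff_or,
    mem_map_ring, map_inv₀, map_eq_zero]

theorem map_hasValue_iff {u : K} {c : k} :
    (f.map P).HasValue u c ↔ P.HasValue (f.pullback u) c := by
  rw [CurvePoint.HasValue, map_valuation_lt_one_iff, map_sub, f.pullback.commutes]
  rfl

theorem map_hasPole_iff {u : K} : (f.map P).HasPole u ↔ P.HasPole (f.pullback u) := Iff.rfl

variable {t : L}

theorem le_pow_iff (ht : P.IsUniformizer t) (e : ℕ) :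
    (IsLocalRing.maximalIdeal (f.map P).ring).map (f.localRingHom P) ≤
      IsLocalRing.maximalIdeal P.ring ^ e ↔
    ∀ u : K, (f.map P).ring.valuation u < 1 →
      P.ring.valuation (f.pullback u) ≤ P.ring.valuation t ^ e := by
  rw [Ideal.map_le_iff_le_comap]
  constructor
  · intro h u hu
    have hu' : u ∈ (f.map P).ring := (ValuationSubring.valuation_le_one_iff _ _).mp hu.le
    have := h ((ValuationSubring.valuation_lt_one_iff _ ⟨u, hu'⟩).mpr hu)
    rw [Ideal.mem_comap, ht.mem_maximalIdeal_pow] at this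
    exact this
  · intro h u hu
    rw [Ideal.mem_comap, ht.mem_maximalIdeal_pow]
    exact h u ((ValuationSubring.valuation_lt_one_iff _ u).mp hu)

/-- The admissible exponents form exactly the interval up to `e`: the bound `h` admits `e`, and `s`
excludes anything larger. Hence the supremum is attained and is not the default value of an
unbounded set. -/
theorem ramificationIndex_eq (ht : P.IsUniformizer t) {e : ℕ} {s : K}
    (hs : (f.map P).ring.valuation s < 1)
    (he : P.ring.valuation (f.pullback s) = P.ring.valuation t ^ e)
    (h : ∀ u : K, (f.map P).ring.valuation u < 1 →
      P.ring.valuation (f.pullback u) ≤ P.ring.valuation t ^ e) :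
    f.ramificationIndex P = e := by
  have hset : {e : ℕ | (IsLocalRing.maximalIdeal (f.map P).ring).map (f.localRingHom P) ≤
      IsLocalRing.maximalIdeal P.ring ^ e} = Set.Iic e := by
    ext n
    rw [Set.mem_ofPred_eq, le_pow_iff f ht, Set.mem_Iic]
    have hpos : 0 < P.ring.valuation t := by simpa [zero_lt_iff] using ht.1
    constructor
    · intro hn
      have := hn s hs
      rw [he] at this
      exact (pow_le_pow_iff_right_of_lt_one₀ hpos ht.2.1).mp this
    · intro hn u hu
      exact (h u hu).trans ((pow_le_pow_iff_right_of_lt_one₀ hpos ht.2.1).mpr hn)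
  rw [ramificationIndex, hset, csSup_Iic]

/-- To see that a point is unramified, one function downstairs that pulls back to a local parameter
is enough; no local parameter on the target need be known. -/
theorem ramificationIndex_eq_one (ht : P.IsUniformizer t) {s : K}
    (hs : P.ring.valuation (f.pullback s) = P.ring.valuation t) :
    f.ramificationIndex P = 1 := by
  refine f.ramificationIndex_eq (s := s) ht ?_ (by rw [hs, pow_one]) fun u hu => ?_
  · rw [map_valuation_lt_one_iff, hs]
    exact ht.2.1
  · rw [pow_one]
    exact ht.valuation_le_of_lt_one ((f.map_valuation_lt_one_iff).mp hu)

theorem ramificationIndex_eq_of_isUniformizer (ht : P.IsUniformizer t) {e : ℕ} {s : K}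
    (hs : (f.map P).IsUniformizer s)
    (he : P.ring.valuation (f.pullback s) = P.ring.valuation t ^ e) :
    f.ramificationIndex P = e := by
  refine f.ramificationIndex_eq ht hs.2.1 he fun u hu => ?_
  obtain ⟨a, rfl⟩ := ((f.map P).ring.valuation_le_iff _ _).mp (hs.valuation_le_of_lt_one hu)
  rw [map_mul, map_mul, he]
  exact mul_le_of_le_one_left' ((P.ring.valuation_le_one_iff _).mpr a.2)

end CurveMorphism

/-- `K` is the function field of the curve `y² = Q(x)` over `k`, with `Q` of odd degree. -/
structure IsDoubleCover {k K : Type*} [Field k] [Field K] [Algebra k K] (x y : K) (Q : k[X]) :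
    Prop where
  transcendental : Transcendental k x
  sq_eq : y ^ 2 = aeval x Q
  odd : Odd Q.natDegree
  exists_eq : ∀ z : K, ∃ p q r : k[X], r ≠ 0 ∧ z * aeval x r = aeval x p + aeval x q * y

/-- Only the relation for the square of the root is used, so `F` need not be monic; this covers the
equation of C with its coefficient -√5. -/
theorem AdjoinRoot.exists_eq_of_add_of_mul_root {R : Type*} [CommRing R] {F : R[X]} {c : R}
    (hroot : AdjoinRoot.root F ^ 2 = AdjoinRoot.of F c) (r : AdjoinRoot F) :
    ∃ p q : R, r = AdjoinRoot.of F p + AdjoinRoot.of F q * AdjoinRoot.root F := by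
  induction r using AdjoinRoot.induction_on with
  | ih g =>
    induction g using Polynomial.induction_on with
    | C p => exact ⟨p, 0, by simp⟩
    | add g g' hg hg' =>
      obtain ⟨p, q, e⟩ := hg
      obtain ⟨p', q', e'⟩ := hg'
      refine ⟨p + p', q + q', ?_⟩
      rw [map_add, e, e', map_add, map_add]; ring
    | monomial n d hd =>
      obtain ⟨p, q, e⟩ := hd
      refine ⟨q * c, p, ?_⟩
      rw [pow_succ, ← mul_assoc, map_mul, e, map_mul, AdjoinRoot.mk_X, ← hroot]; ring

/-- Chevalley's extension theorem: `φ` extends to the localization at `I`, and a local ring mapping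
to a field is dominated by a valuation ring. All points are constructed this way. -/
theorem exists_valuationSubring_of_ringHom {R K : Type*} [CommRing R] [Field K] (φ : R →+* K)
    (I : Ideal R) [I.IsPrime] (h : ∀ r, r ∉ I → φ r ≠ 0) :
    ∃ V : ValuationSubring K, ∀ r, φ r ∈ V ∧ (r ∈ I → V.valuation (φ r) < 1) := by
  let ψ : Localization.AtPrime I →+* K :=
    IsLocalization.lift (M := I.primeCompl) (g := φ) fun s => (h s s.2).isUnit
  have hψ : ∀ r, ψ (algebraMap R _ r) = φ r := fun r => IsLocalization.lift_eq _ r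
  obtain ⟨V, hV, hloc⟩ := IsLocalRing.exists_factor_valuationRing ψ
  have hmem : ∀ r, φ r ∈ V := fun r => by rw [← hψ]; exact hV _
  refine ⟨V, fun r => ⟨hmem r, fun hr => ?_⟩⟩
  refine (V.valuation_lt_one_iff ⟨φ r, hmem r⟩).mp ((IsLocalRing.mem_maximalIdeal _).mpr ?_)
  intro hu
  have e : ψ.codRestrict V.toSubring hV (algebraMap R _ r) = (⟨φ r, hmem r⟩ : V) :=
    Subtype.ext (hψ r)
  have hu' : IsUnit (ψ.codRestrict V.toSubring hV (algebraMap R _ r)) := by rw [e]; exact hu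
  have := (IsLocalization.AtPrime.isUnit_to_map_iff (Localization.AtPrime I) I r).mp
    (hloc.map_nonunit _ hu')
  exact this hr

/-! ### Independence of 1 and y over k(x), and points of a double cover -/

namespace IsDoubleCover

variable {k K : Type*} [Field k] [Field K] [Algebra k K] {x y : K} {Q : k[X]}

theorem aeval_ne_zero (h : IsDoubleCover x y Q) {p : k[X]} (hp : p ≠ 0) : aeval x p ≠ 0 :=
  fun h0 => h.transcendental ⟨p, hp, h0⟩

theorem aeval_injective (h : IsDoubleCover x y Q) : Function.Injective (aeval (R := k) x) :=
  transcendental_iff_injective.mp h.transcendental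

theorem poly_ne_zero (h : IsDoubleCover x y Q) : Q ≠ 0 := by
  rintro rfl
  simpa using h.odd

theorem y_ne_zero (h : IsDoubleCover x y Q) : y ≠ 0 := by
  rintro rfl
  exact h.aeval_ne_zero h.poly_ne_zero (by rw [← h.sq_eq]; simp)

/-- Parity: p² has even degree, while q²Q has odd degree unless q = 0. -/
theorem norm_eq_zero (h : IsDoubleCover x y Q) {p q : k[X]} (h0 : p ^ 2 - q ^ 2 * Q = 0) :
    p = 0 ∧ q = 0 := by
  have hq : q = 0 := by
    by_contra hq
    have h1 := congrArg natDegree (sub_eq_zero.mp h0)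
    rw [natDegree_pow, natDegree_mul (pow_ne_zero 2 hq) h.poly_ne_zero, natDegree_pow] at h1
    have := h.odd
    grind
  subst hq
  simpa using h0

theorem add_mul_eq_zero (h : IsDoubleCover x y Q) {p q : k[X]}
    (h0 : aeval x p + aeval x q * y = 0) : p = 0 ∧ q = 0 := by
  refine h.norm_eq_zero (h.aeval_injective ?_)
  simp only [map_sub, map_pow, map_mul, map_zero, ← h.sq_eq]
  linear_combination (aeval x p - aeval x q * y) * h0

theorem exists_eq_mul (h : IsDoubleCover x y Q) (p q p' q' : k[X]) :
    (aeval x p + aeval x q * y) * (aeval x p' + aeval x q' * y) =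
      aeval x (p * p' + q * q' * Q) + aeval x (p * q' + q * p') * y := by
  simp only [map_add, map_mul, ← h.sq_eq]
  ring

/-! ### Existence of points -/

/-- Dominate the local ring at the origin of k[X], embedded in `K` by X ↦ 1/x. -/
theorem exists_hasPole (h : IsDoubleCover x y Q) : ∃ P : CurvePoint k K, P.HasPole x := by
  have htr : Transcendental k x⁻¹ := fun hx => h.transcendental (by simpa using hx.inv)
  have : (Ideal.span {(X : k[X])}).IsPrime :=
    (Ideal.span_singleton_prime X_ne_zero).mpr prime_X
  obtain ⟨V, hV⟩ := exists_valuationSubring_of_ringHom (aeval (R := k) x⁻¹).toRingHom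
    (Ideal.span {(X : k[X])}) (fun r hr h0 => htr ⟨r, by rintro rfl; simp at hr, h0⟩)
  have hx : x⁻¹ ∈ V.nonunits := by
    have := (hV X).2 (Ideal.mem_span_singleton_self _)
    simpa [ValuationSubring.mem_nonunits_iff] using this
  have hx0 : x ≠ 0 := by
    have := h.aeval_ne_zero (X_ne_zero (R := k))
    simpa using this
  have hxV : x ∉ V := by simpa [ValuationSubring.inv_mem_nonunits_iff, hx0] using hx
  refine ⟨⟨V, fun c => ?_, ?_⟩, hxV⟩
  · simpa using (hV (C c)).1
  · rintro rfl
    exact hxV (ValuationSubring.mem_top x)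

/-- The prime ideal to be dominated is the kernel of evaluation at (a, b) on the coordinate ring. -/
theorem exists_hasValue (h : IsDoubleCover x y Q) {a b : k} (hab : b ^ 2 = Q.eval a) :
    ∃ P : CurvePoint k K, P.HasValue x a ∧ P.HasValue y b := by
  let F : k[X][X] := X ^ 2 - C Q
  let φ : AdjoinRoot F →+* K :=
    AdjoinRoot.lift (aeval (R := k) x).toRingHom y (by simp [F, h.sq_eq])
  let ev : AdjoinRoot F →+* k := AdjoinRoot.lift (evalRingHom a) b (by simp [F, hab])
  have hroot : AdjoinRoot.root F ^ 2 = AdjoinRoot.of F Q := by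
    have := AdjoinRoot.eval₂_root F
    simpa [F, sub_eq_zero] using this
  have : (RingHom.ker ev).IsPrime := RingHom.ker_isPrime ev
  obtain ⟨V, hV⟩ := exists_valuationSubring_of_ringHom φ (RingHom.ker ev) (by
    intro r hr h0
    obtain ⟨p, q, rfl⟩ := AdjoinRoot.exists_eq_of_add_of_mul_root hroot r
    obtain ⟨rfl, rfl⟩ := h.add_mul_eq_zero (p := p) (q := q) (by simpa [φ] using h0)
    simp at hr)
  have hx := (hV (AdjoinRoot.of F (X - C a))).2 (by simp [RingHom.mem_ker, ev])
  have hy := (hV (AdjoinRoot.root F - AdjoinRoot.of F (C b))).2 (by simp [RingHom.mem_ker, ev])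
  simp only [φ, map_sub, AdjoinRoot.lift_of, AdjoinRoot.lift_root] at hx hy
  refine ⟨⟨V, fun c => ?_, ?_⟩, by simpa [CurvePoint.HasValue] using hx,
    by simpa [CurvePoint.HasValue] using hy⟩
  · simpa [φ] using (hV (AdjoinRoot.of F (C c))).1
  · rintro rfl
    rw [← ValuationSubring.mem_nonunits_iff, ValuationSubring.mem_nonunits_iff_or] at hx
    obtain hx | hx := hx
    · exact h.aeval_ne_zero (X_sub_C_ne_zero a) (by simpa using hx)
    · exact hx (ValuationSubring.mem_top _)

theorem hasValue_or_hasPole [IsAlgClosed k] (h : IsDoubleCover x y Q) (P : CurvePoint k K) :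
    P.HasPole x ∨ ∃ a b : k, P.HasValue x a ∧ P.HasValue y b := by
  by_cases hx : x ∈ P.ring
  swap
  · exact Or.inl hx
  right
  have hy : y ∈ P.ring := CurvePoint.mem_of_sq_mem (by
    rw [h.sq_eq]; exact CurvePoint.aeval_mem hx Q)
  have hxa : ∃ a, P.HasValue x a := by
    by_contra! hno
    -- If x took no value, every x - a would be a unit. Over an algebraically closed field every
    -- nonzero polynomial in x would then be a unit too, and the ring would be all of K.
    have hlin : ∀ a : k, P.ring.valuation (x - algebraMap k K a) = 1 := fun a =>
      le_antisymm ((P.ring.valuation_le_one_iff _).mpr (sub_mem hx (P.algebraMap_mem a)))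
        (not_lt.mp (hno a))
    have hall : ∀ r : k[X], r ≠ 0 → P.ring.valuation (aeval x r) = 1 := by
      intro r hr
      rw [(IsAlgClosed.splits r).eq_prod_roots, map_mul, map_mul, aeval_C,
        P.valuation_algebraMap (leadingCoeff_ne_zero.mpr hr), one_mul, map_multiset_prod,
        map_multiset_prod, Multiset.map_map, Multiset.map_map]
      refine Multiset.prod_eq_one fun z hz => ?_
      obtain ⟨a, -, rfl⟩ := Multiset.mem_map.mp hz
      simpa using hlin a
    refine P.ne_top (top_unique fun z _ => ?_)
    obtain ⟨p, q, r, hr, e⟩ := h.exists_eq z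
    rw [← P.ring.valuation_le_one_iff, ← mul_one (P.ring.valuation z), ← hall r hr, ← map_mul, e,
      hall r hr, P.ring.valuation_le_one_iff]
    exact add_mem (CurvePoint.aeval_mem hx p) (mul_mem (CurvePoint.aeval_mem hx q) hy)
  obtain ⟨a, ha⟩ := hxa
  obtain ⟨b, hb⟩ := IsAlgClosed.exists_pow_nat_eq (Q.eval a) two_pos
  have hprod : P.ring.valuation ((y - algebraMap k K b) * (y - algebraMap k K (-b))) < 1 := by
    have := ha.aeval Q
    rw [CurvePoint.HasValue, ← h.sq_eq, ← hb] at this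
    convert this using 2
    simp only [map_neg, map_pow]
    ring
  rw [map_mul] at hprod
  by_cases hyb : P.HasValue y b
  · exact ⟨a, b, ha, hyb⟩
  refine ⟨a, -b, ha, ?_⟩
  have h1 : P.ring.valuation (y - algebraMap k K b) = 1 :=
    le_antisymm ((P.ring.valuation_le_one_iff _).mpr (sub_mem hy (P.algebraMap_mem b)))
      (not_lt.mp hyb)
  rwa [h1, one_mul] at hprod

theorem sq_eq_of_hasValue (h : IsDoubleCover x y Q) {P : CurvePoint k K} {a b : k}
    (hx : P.HasValue x a) (hy : P.HasValue y b) : b ^ 2 = Q.eval a :=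
  (hy.pow 2).unique (h.sq_eq ▸ hx.aeval Q)

end IsDoubleCover

namespace IsDoubleCover

variable {k K : Type*} [Field k] [Field K] [Algebra k K] {x y : K} {Q : k[X]}

/-! ### Local parameters at the finite points -/

variable (x y) in
/-- `u` is a polynomial in `x` and `y` that does not vanish at `(a, b)`. -/
def IsPolyUnit (a b : k) (u : K) : Prop :=
  ∃ p q : k[X], u = aeval x p + aeval x q * y ∧ p.eval a + q.eval a * b ≠ 0

theorem IsPolyUnit.mul (h : IsDoubleCover x y Q) {a b : k} (hab : b ^ 2 = Q.eval a) {u u' : K}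
    (hu : IsPolyUnit x y a b u) (hu' : IsPolyUnit x y a b u') : IsPolyUnit x y a b (u * u') := by
  obtain ⟨p, q, rfl, hne⟩ := hu
  obtain ⟨p', q', rfl, hne'⟩ := hu'
  refine ⟨_, _, h.exists_eq_mul p q p' q', ?_⟩
  convert mul_ne_zero hne hne' using 1
  simp only [eval_add, eval_mul, ← hab]
  ring

theorem isPolyUnit_aeval {a b : k} {p : k[X]} (hp : p.eval a ≠ 0) :
    IsPolyUnit x y a b (aeval x p) :=
  ⟨p, 0, by simp, by simpa using hp⟩

theorem isPolyUnit_one {a b : k} : IsPolyUnit x y a b 1 :=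
  ⟨1, 0, by simp, by simp⟩

theorem IsPolyUnit.valuation_eq_one {a b : k} {u : K} (hu : IsPolyUnit x y a b u)
    {P : CurvePoint k K} (hx : P.HasValue x a) (hy : P.HasValue y b) :
    P.ring.valuation u = 1 := by
  obtain ⟨p, q, rfl, hne⟩ := hu
  exact ((hx.aeval p).add ((hx.aeval q).mul hy)).valuation_eq_one hne

variable (x y) in
open Classical in
/-- A local parameter at the point `(a, b)`. -/
noncomputable def localParam (a b : k) : K := if b = 0 then y else x - algebraMap k K a

theorem localParam_ne_zero (h : IsDoubleCover x y Q) (a b : k) : localParam x y a b ≠ 0 := by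
  unfold localParam
  split_ifs
  · exact h.y_ne_zero
  · have := h.aeval_ne_zero (X_sub_C_ne_zero a)
    simpa using this

theorem valuation_localParam_lt {P : CurvePoint k K} {a b : k} (hx : P.HasValue x a)
    (hy : P.HasValue y b) : P.ring.valuation (localParam x y a b) < 1 := by
  unfold localParam
  split_ifs with hb
  · subst hb
    exact CurvePoint.hasValue_zero_iff.mp hy
  · exact hx

/-- A polynomial in `x` and `y` is a power of the local parameter up to units. -/
theorem exists_mul_eq_pow_mul [CharZero k] (h : IsDoubleCover x y Q) (hQ : ∀ a, Q.eval a = 0 →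
    Q.derivative.eval a ≠ 0) {a b : k} (hab : b ^ 2 = Q.eval a) (m : ℕ) :
    ∀ p q : k[X], ¬ (X - C a) ^ m ∣ p ^ 2 - q ^ 2 * Q →
      ∃ (n : ℕ) (s w : K), IsPolyUnit x y a b s ∧ IsPolyUnit x y a b w ∧
        (aeval x p + aeval x q * y) * s = localParam x y a b ^ n * w := by
  induction m with
  | zero => intro p q hd; simp at hd
  | succ m ih =>
    intro p q hd
    by_cases hr : p.eval a + q.eval a * b = 0
    swap
    · exact ⟨0, 1, _, isPolyUnit_one, ⟨p, q, rfl, hr⟩, by simp⟩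
    by_cases hb : b = 0
    · subst hb
      have hp : p.eval a = 0 := by simpa using hr
      obtain ⟨p₁, rfl⟩ := dvd_iff_isRoot.mpr hp
      have hQa : Q.eval a = 0 := by simpa using hab.symm
      obtain ⟨Q₁, hQ₁⟩ := dvd_iff_isRoot.mpr hQa
      have hQ₁a : Q₁.eval a ≠ 0 := by
        have := hQ a hQa
        rw [hQ₁] at this
        simpa [derivative_mul] using this
      have hcop : IsCoprime ((X - C a) ^ m) Q₁ := by
        refine IsCoprime.pow_left ((irreducible_X_sub_C a).coprime_iff_not_dvd.mpr ?_)
        rwa [dvd_iff_isRoot]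
      -- At a branch point (x - a)Q₁ = y², so Q₁(p + qy) = y(qQ₁ + p₁y). The new norm is Q₁ times a
      -- polynomial that, multiplied by -(X - a), gives the old norm; as Q₁(a) ≠ 0, the multiplicity
      -- of a drops by one.
      obtain ⟨n, s, w, hs, hw, e⟩ := ih (q * Q₁) p₁ (by
        intro hdiv
        apply hd
        have e : (q * Q₁) ^ 2 - p₁ ^ 2 * Q = (q ^ 2 * Q₁ - p₁ ^ 2 * (X - C a)) * Q₁ := by
          rw [hQ₁]; ring
        rw [e] at hdiv
        obtain ⟨c, hc⟩ := hcop.dvd_of_dvd_mul_right hdiv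
        refine ⟨-c, ?_⟩
        rw [hQ₁]
        linear_combination (-(X - C a)) * hc)
      refine ⟨n + 1, aeval x Q₁ * s, w, (isPolyUnit_aeval hQ₁a).mul h hab hs, hw, ?_⟩
      have hy2 : aeval x (X - C a) * aeval x Q₁ = y ^ 2 := by
        rw [← map_mul, ← hQ₁, h.sq_eq]
      have ht : localParam x y a 0 = y := by simp [localParam]
      rw [ht] at e ⊢
      rw [map_mul] at e ⊢
      linear_combination (aeval x p₁ * s) * hy2 + y * e
    · have ht : localParam x y a b = aeval x (X - C a) := by simp [localParam, hb]
      by_cases hr' : p.eval a - q.eval a * b = 0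
      -- Both p + qy and its conjugate vanish at (a, b) with b ≠ 0, so X - a divides p and q.
      · have hp : p.eval a = 0 := by
          have : 2 * p.eval a = 0 := by linear_combination hr + hr'
          exact (mul_eq_zero.mp this).resolve_left two_ne_zero
        have hq : q.eval a = 0 := by
          rw [hp, zero_add] at hr
          exact (mul_eq_zero.mp hr).resolve_right hb
        obtain ⟨p₁, rfl⟩ := dvd_iff_isRoot.mpr hp
        obtain ⟨q₁, rfl⟩ := dvd_iff_isRoot.mpr hq
        obtain ⟨n, s, w, hs, hw, e⟩ := ih p₁ q₁ (by
          rintro ⟨c, hc⟩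
          exact hd ⟨(X - C a) * c, by linear_combination (X - C a) ^ 2 * hc⟩)
        refine ⟨n + 1, s, w, hs, hw, ?_⟩
        rw [ht] at e ⊢
        rw [map_mul, map_mul]
        linear_combination aeval x (X - C a) * e
      -- Here the conjugate p - qy does not vanish at (a, b). Multiplying by it gives the norm, a
      -- polynomial in x alone.
      · have hN : p ^ 2 - q ^ 2 * Q ≠ 0 := fun h0 => hd (h0 ▸ dvd_zero _)
        obtain ⟨N, hN', hNa⟩ := exists_eq_pow_rootMultiplicity_mul_and_not_dvd _ hN a
        rw [dvd_iff_isRoot] at hNa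
        refine ⟨rootMultiplicity a (p ^ 2 - q ^ 2 * Q), aeval x p - aeval x q * y,
          aeval x N, ⟨p, -q, by simp [sub_eq_add_neg],
          by simpa [sub_eq_add_neg] using hr'⟩, isPolyUnit_aeval hNa, ?_⟩
        rw [ht, ← map_pow, ← map_mul, ← hN']
        simp only [map_sub, map_pow, map_mul, ← h.sq_eq]
        ring

/-- The exponent and the two units depend on (a, b) but on no point of the curve. Hence the local
ring is determined by (a, b), which gives uniqueness of the point. -/
theorem exists_mul_eq_zpow_mul [CharZero k] (h : IsDoubleCover x y Q) (hQ : ∀ a, Q.eval a = 0 →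
    Q.derivative.eval a ≠ 0) {a b : k} (hab : b ^ 2 = Q.eval a) {z : K} (hz : z ≠ 0) :
    ∃ (n : ℤ) (s w : K), IsPolyUnit x y a b s ∧ IsPolyUnit x y a b w ∧
      z * s = localParam x y a b ^ n * w := by
  have key : ∀ p q : k[X], aeval x p + aeval x q * y ≠ 0 →
      ∃ (n : ℕ) (s w : K), IsPolyUnit x y a b s ∧ IsPolyUnit x y a b w ∧
        (aeval x p + aeval x q * y) * s = localParam x y a b ^ n * w := by
    intro p q hne
    have hN : p ^ 2 - q ^ 2 * Q ≠ 0 := by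
      intro h0
      obtain ⟨rfl, rfl⟩ := h.norm_eq_zero h0
      simp at hne
    refine h.exists_mul_eq_pow_mul hQ hab (rootMultiplicity a (p ^ 2 - q ^ 2 * Q) + 1) p q ?_
    rw [← le_rootMultiplicity_iff hN]
    exact Nat.not_succ_le_self _
  obtain ⟨p, q, r, hr, e⟩ := h.exists_eq z
  have hr' := h.aeval_ne_zero hr
  obtain ⟨n₁, s₁, w₁, hs₁, hw₁, e₁⟩ := key p q (e ▸ mul_ne_zero hz hr')
  obtain ⟨n₂, s₂, w₂, hs₂, hw₂, e₂⟩ := key r 0 (by simpa using hr')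
  rw [map_zero, zero_mul, add_zero] at e₂
  have ht := h.localParam_ne_zero a b
  refine ⟨n₁ - n₂, w₂ * s₁, w₁ * s₂, hw₂.mul h hab hs₁, hw₁.mul h hab hs₂, ?_⟩
  rw [zpow_sub₀ ht, zpow_natCast, zpow_natCast]
  field_simp
  linear_combination (-z * s₁) * e₂ + s₁ * s₂ * e + s₂ * e₁

theorem isUniformizer_localParam [CharZero k] (h : IsDoubleCover x y Q) (hQ : ∀ a, Q.eval a = 0 →
    Q.derivative.eval a ≠ 0) {P : CurvePoint k K} {a b : k} (hx : P.HasValue x a)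
    (hy : P.HasValue y b) : P.IsUniformizer (localParam x y a b) := by
  refine ⟨h.localParam_ne_zero a b, valuation_localParam_lt hx hy, fun r hr => ?_⟩
  obtain ⟨n, s, w, hs, hw, e⟩ := h.exists_mul_eq_zpow_mul hQ (h.sq_eq_of_hasValue hx hy) hr
  refine ⟨n, ?_⟩
  have := congrArg P.ring.valuation e
  rwa [map_mul, map_mul, hs.valuation_eq_one hx hy, hw.valuation_eq_one hx hy, mul_one, mul_one,
    map_zpow₀] at this

/-- The local ring at `(a, b)` is the localization of the coordinate ring. -/
theorem mem_iff_exists [CharZero k] (h : IsDoubleCover x y Q) (hQ : ∀ a, Q.eval a = 0 →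
    Q.derivative.eval a ≠ 0) {P : CurvePoint k K} {a b : k} (hx : P.HasValue x a)
    (hy : P.HasValue y b) (z : K) :
    z ∈ P.ring ↔ ∃ (p q : k[X]) (s : K), IsPolyUnit x y a b s ∧
      z * s = aeval x p + aeval x q * y := by
  have hmem : ∀ p q : k[X], aeval x p + aeval x q * y ∈ P.ring := fun p q =>
    add_mem (CurvePoint.aeval_mem hx.mem p) (mul_mem (CurvePoint.aeval_mem hx.mem q) hy.mem)
  constructor
  · intro hz
    obtain rfl | h0 := eq_or_ne z 0
    · exact ⟨0, 0, 1, isPolyUnit_one, by simp⟩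
    obtain ⟨n, s, w, hs, ⟨p, q, rfl, hw⟩, e⟩ :=
      h.exists_mul_eq_zpow_mul hQ (h.sq_eq_of_hasValue hx hy) h0
    have hn : 0 ≤ n := by
      by_contra hn
      have hv := congrArg P.ring.valuation e
      have hpos : 0 < P.ring.valuation (localParam x y a b) := by
        simpa [zero_lt_iff] using h.localParam_ne_zero a b
      rw [map_mul, map_mul, hs.valuation_eq_one hx hy, mul_one, map_zpow₀,
        IsPolyUnit.valuation_eq_one ⟨p, q, rfl, hw⟩ hx hy, mul_one] at hv
      have h1 : P.ring.valuation z ≤ 1 := (P.ring.valuation_le_one_iff _).mpr hz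
      rw [hv] at h1
      exact absurd h1 (not_le.mpr
        (one_lt_zpow_of_neg₀ hpos (valuation_localParam_lt hx hy) (not_le.mp hn)))
    obtain ⟨n, rfl⟩ := Int.eq_ofNat_of_zero_le hn
    have hpoly : ∀ n : ℕ, ∃ p' q' : k[X],
        localParam x y a b ^ n * (aeval x p + aeval x q * y) = aeval x p' + aeval x q' * y := by
      intro n
      induction n with
      | zero => exact ⟨p, q, by simp⟩
      | succ n ih =>
        obtain ⟨p', q', e'⟩ := ih
        obtain ⟨p₀, q₀, e₀⟩ : ∃ p₀ q₀ : k[X],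
            localParam x y a b = aeval x p₀ + aeval x q₀ * y := by
          unfold localParam
          split_ifs
          · exact ⟨0, 1, by simp⟩
          · exact ⟨X - C a, 0, by simp⟩
        exact ⟨_, _, by
          rw [pow_succ', mul_assoc, e', e₀]; exact h.exists_eq_mul p₀ q₀ p' q'⟩
    obtain ⟨p', q', e'⟩ := hpoly n
    exact ⟨p', q', s, hs, by rw [e, zpow_natCast, e']⟩
  · rintro ⟨p, q, s, hs, e⟩
    rw [← P.ring.valuation_le_one_iff, ← mul_one (P.ring.valuation z),
      ← hs.valuation_eq_one hx hy, ← map_mul, e,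
      hs.valuation_eq_one hx hy, P.ring.valuation_le_one_iff]
    exact hmem p q

theorem existsUnique_hasValue [CharZero k] (h : IsDoubleCover x y Q) (hQ : ∀ a, Q.eval a = 0 →
    Q.derivative.eval a ≠ 0) {a b : k} (hab : b ^ 2 = Q.eval a) :
    ∃! P : CurvePoint k K, P.HasValue x a ∧ P.HasValue y b := by
  refine existsUnique_of_exists_of_unique (h.exists_hasValue hab) ?_
  rintro P P' ⟨hx, hy⟩ ⟨hx', hy'⟩
  refine CurvePoint.ext_ring (SetLike.ext fun z => ?_)
  rw [h.mem_iff_exists hQ hx hy, h.mem_iff_exists hQ hx' hy']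

/-! ### The point at infinity -/

variable {P : CurvePoint k K}

/-- Where x has a pole the leading term strictly dominates the rest. -/
theorem valuation_aeval_of_hasPole (hP : P.HasPole x) {p : k[X]} (hp : p ≠ 0) :
    P.ring.valuation (aeval x p) = P.ring.valuation x ^ p.natDegree := by
  have hx : 1 < P.ring.valuation x := CurvePoint.hasPole_iff.mp hP
  induction hd : p.natDegree using Nat.strong_induction_on generalizing p with
  | _ d ih =>
    subst hd
    have hlead : P.ring.valuation (aeval x (C p.leadingCoeff * X ^ p.natDegree)) =
        P.ring.valuation x ^ p.natDegree := by
      simp [P.valuation_algebraMap (leadingCoeff_ne_zero.mpr hp)]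
    rw [← hlead, ← eraseLead_add_C_mul_X_pow p, map_add,
      eraseLead_add_C_mul_X_pow p]
    apply Valuation.map_add_eq_of_lt_right
    rw [hlead]
    obtain h0 | h0 := eq_or_ne p.eraseLead 0
    · rw [h0, map_zero, map_zero]
      exact pow_pos (zero_lt_one.trans hx) _
    · have hlt : p.eraseLead.natDegree < p.natDegree := by
        refine eraseLead_natDegree_lt ?_
        by_contra hc
        have : p.support.card ≤ 1 := by omega
        have := card_support_eraseLead (f := p)
        exact h0 (card_support_eq_zero.mp (by omega))
      rw [ih _ hlt h0 rfl]
      exact pow_lt_pow_right₀ hx hlt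

theorem valuation_y_sq (h : IsDoubleCover x y Q) (hP : P.HasPole x) :
    P.ring.valuation y ^ 2 = P.ring.valuation x ^ Q.natDegree := by
  rw [← map_pow, h.sq_eq, valuation_aeval_of_hasPole hP h.poly_ne_zero]

/-- The square of x^m / y is x^(2m) / Q(x), which behaves like 1/x. So x^m / y is the candidate
local parameter, and x has order -2 in it. -/
theorem valuation_param_sq (h : IsDoubleCover x y Q) (hP : P.HasPole x) {m : ℕ}
    (hm : Q.natDegree = 2 * m + 1) :
    P.ring.valuation (x ^ m / y) ^ 2 = (P.ring.valuation x)⁻¹ := by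
  have hx : P.ring.valuation x ≠ 0 := (zero_lt_one.trans (CurvePoint.hasPole_iff.mp hP)).ne'
  rw [map_div₀, div_pow, h.valuation_y_sq hP, hm, map_pow]
  field_simp
  rw [← pow_mul, ← pow_succ, mul_comm m 2]

theorem valuation_x_eq (h : IsDoubleCover x y Q) (hP : P.HasPole x) {m : ℕ}
    (hm : Q.natDegree = 2 * m + 1) :
    P.ring.valuation x = P.ring.valuation (x ^ m / y) ^ (-2 : ℤ) := by
  rw [zpow_neg, show (2 : ℤ) = ((2 : ℕ) : ℤ) from rfl, zpow_natCast, h.valuation_param_sq hP hm,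
    inv_inv]

theorem param_ne_zero (h : IsDoubleCover x y Q) (m : ℕ) : x ^ m / y ≠ 0 := by
  have := h.aeval_ne_zero (X_ne_zero (R := k))
  rw [aeval_X] at this
  exact div_ne_zero (pow_ne_zero _ this) h.y_ne_zero

theorem valuation_y_eq (h : IsDoubleCover x y Q) (hP : P.HasPole x) {m : ℕ}
    (hm : Q.natDegree = 2 * m + 1) :
    P.ring.valuation y = P.ring.valuation (x ^ m / y) ^ (-(2 * m + 1) : ℤ) := by
  have hT : P.ring.valuation (x ^ m / y) ≠ 0 := by simpa using h.param_ne_zero m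
  have hy : P.ring.valuation y ≠ 0 := by simpa using h.y_ne_zero
  have e : P.ring.valuation (x ^ m / y) * P.ring.valuation y = P.ring.valuation x ^ m := by
    rw [← map_mul, div_mul_cancel₀ _ h.y_ne_zero, map_pow]
  rw [h.valuation_x_eq hP hm] at e
  rw [eq_comm, ← mul_left_cancel_iff_of_pos (zero_lt_iff.mpr hT), e,
    ← zpow_natCast (_ ^ (-2 : ℤ)), ← zpow_mul, ← zpow_one_add₀ hT]
  congr 1
  ring

theorem valuation_param_lt_one (h : IsDoubleCover x y Q) (hP : P.HasPole x) {m : ℕ}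
    (hm : Q.natDegree = 2 * m + 1) : P.ring.valuation (x ^ m / y) < 1 := by
  have hx := CurvePoint.hasPole_iff.mp hP
  have := h.valuation_param_sq hP hm
  by_contra! hge
  have h1 : 1 ≤ (P.ring.valuation x)⁻¹ := this ▸ one_le_pow₀ hge
  exact absurd h1 (not_le.mpr (inv_lt_one_of_one_lt₀ hx))

theorem zpow_param_injective (h : IsDoubleCover x y Q) (hP : P.HasPole x) {m : ℕ}
    (hm : Q.natDegree = 2 * m + 1) :
    Function.Injective fun n : ℤ => P.ring.valuation (x ^ m / y) ^ n :=
  (zpow_right_strictAnti₀ (zero_lt_iff.mpr (by simpa using h.param_ne_zero m))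
    (h.valuation_param_lt_one hP hm)).injective

theorem valuation_aeval_eq (h : IsDoubleCover x y Q) (hP : P.HasPole x) {m : ℕ}
    (hm : Q.natDegree = 2 * m + 1) {p : k[X]} (hp : p ≠ 0) :
    P.ring.valuation (aeval x p) =
      P.ring.valuation (x ^ m / y) ^ (-(2 * p.natDegree) : ℤ) := by
  rw [valuation_aeval_of_hasPole hP hp, h.valuation_x_eq hP hm, ← zpow_natCast, ← zpow_mul]
  congr 1

theorem valuation_aeval_mul_eq (h : IsDoubleCover x y Q) (hP : P.HasPole x) {m : ℕ}
    (hm : Q.natDegree = 2 * m + 1) {q : k[X]} (hq : q ≠ 0) :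
    P.ring.valuation (aeval x q * y) =
      P.ring.valuation (x ^ m / y) ^ (-(2 * q.natDegree + 2 * m + 1) : ℤ) := by
  have hT : P.ring.valuation (x ^ m / y) ≠ 0 := by simpa using h.param_ne_zero m
  rw [map_mul, h.valuation_aeval_eq hP hm hq, h.valuation_y_eq hP hm, ← zpow_add₀ hT]
  congr 1
  ring

/-- The first summand has even order at infinity and the second odd order, so they cannot cancel. -/
theorem valuation_add_mul (h : IsDoubleCover x y Q) (hP : P.HasPole x) (p q : k[X]) :
    P.ring.valuation (aeval x p + aeval x q * y) =
      max (P.ring.valuation (aeval x p)) (P.ring.valuation (aeval x q * y)) := by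
  obtain rfl | hp := eq_or_ne p 0
  · simp
  obtain rfl | hq := eq_or_ne q 0
  · simp
  obtain ⟨m, hm⟩ := h.odd
  refine Valuation.map_add_of_distinct_val _ ?_
  rw [h.valuation_aeval_eq hP hm hp, h.valuation_aeval_mul_eq hP hm hq]
  intro e
  have := h.zpow_param_injective hP hm e
  omega

/-- The exponent is chosen before the point `P`; this uniformity makes the point at infinity unique.
-/
theorem exists_valuation_eq_zpow (h : IsDoubleCover x y Q) {m : ℕ}
    (hm : Q.natDegree = 2 * m + 1) {z : K} (hz : z ≠ 0) :
    ∃ n : ℤ, ∀ P : CurvePoint k K, P.HasPole x →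
      P.ring.valuation z = P.ring.valuation (x ^ m / y) ^ n := by
  have key : ∀ p q : k[X], aeval x p + aeval x q * y ≠ 0 → ∃ n : ℤ, ∀ P : CurvePoint k K,
      P.HasPole x → P.ring.valuation (aeval x p + aeval x q * y) =
        P.ring.valuation (x ^ m / y) ^ n := by
    intro p q hne
    obtain rfl | hp := eq_or_ne p 0
    · have hq : q ≠ 0 := by rintro rfl; simp at hne
      exact ⟨_, fun P hP => by
        rw [map_zero, zero_add]; exact h.valuation_aeval_mul_eq hP hm hq⟩
    obtain rfl | hq := eq_or_ne q 0
    · exact ⟨_, fun P hP => by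
        rw [map_zero, zero_mul, add_zero]; exact h.valuation_aeval_eq hP hm hp⟩
    refine ⟨min (-(2 * p.natDegree) : ℤ) (-(2 * q.natDegree + 2 * m + 1)), fun P hP => ?_⟩
    rw [h.valuation_add_mul hP, h.valuation_aeval_eq hP hm hp, h.valuation_aeval_mul_eq hP hm hq]
    exact ((zpow_right_strictAnti₀ (zero_lt_iff.mpr (by simpa using h.param_ne_zero m))
      (h.valuation_param_lt_one hP hm)).antitone.map_min).symm
  obtain ⟨p, q, r, hr, e⟩ := h.exists_eq z
  have hr' := h.aeval_ne_zero hr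
  obtain ⟨n₁, h₁⟩ := key p q (e ▸ mul_ne_zero hz hr')
  obtain ⟨n₂, h₂⟩ := key r 0 (by simpa using hr')
  refine ⟨n₁ - n₂, fun P hP => ?_⟩
  have hT : P.ring.valuation (x ^ m / y) ≠ 0 := by simpa using h.param_ne_zero m
  have e' := h₂ P hP
  rw [map_zero, zero_mul, add_zero] at e'
  rw [zpow_sub₀ hT, ← h₁ P hP, ← e', ← e, ← map_div₀, mul_div_cancel_right₀ _ hr']

theorem isUniformizer_param (h : IsDoubleCover x y Q) {m : ℕ}
    (hm : Q.natDegree = 2 * m + 1) (hP : P.HasPole x) : P.IsUniformizer (x ^ m / y) := by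
  refine ⟨h.param_ne_zero m, h.valuation_param_lt_one hP hm, fun r hr => ?_⟩
  obtain ⟨n, hn⟩ := h.exists_valuation_eq_zpow hm hr
  exact ⟨n, hn P hP⟩

theorem hasPole_unique (h : IsDoubleCover x y Q) {P P' : CurvePoint k K} (hP : P.HasPole x)
    (hP' : P'.HasPole x) : P = P' := by
  obtain ⟨m, hm⟩ := h.odd
  have key : ∀ P : CurvePoint k K, P.HasPole x → ∀ n : ℤ,
      P.ring.valuation (x ^ m / y) ^ n ≤ 1 ↔ 0 ≤ n := fun P hP n =>
    zpow_le_one_iff_right_of_lt_one₀ (zero_lt_iff.mpr (by simpa using h.param_ne_zero m))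
      (h.valuation_param_lt_one hP hm)
  refine CurvePoint.ext_ring (SetLike.ext fun z => ?_)
  obtain rfl | hz := eq_or_ne z 0
  · simp
  obtain ⟨n, hn⟩ := h.exists_valuation_eq_zpow hm hz
  rw [← ValuationSubring.valuation_le_one_iff, ← ValuationSubring.valuation_le_one_iff,
    hn P hP, hn P' hP', key P hP, key P' hP']

theorem existsUnique_hasPole (h : IsDoubleCover x y Q) : ∃! P : CurvePoint k K, P.HasPole x :=
  existsUnique_of_exists_of_unique h.exists_hasPole fun _ _ => h.hasPole_unique

end IsDoubleCover

/-! ### Differentials as multiples of dx / y -/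

namespace IsDoubleCover

variable {k K : Type*} [Field k] [Field K] [Algebra k K] {x y : K} {Q : k[X]}

/-- The differentials of `K` are the multiples of `dx`. -/
theorem exists_linearEquiv_dx [CharZero k] (h : IsDoubleCover x y Q) :
    ∃ e : Ω[K⁄k] ≃ₗ[K] K, e (KaehlerDifferential.D k K x) = 1 := by
  let : Algebra k[X] K := (aeval (R := k) x).toRingHom.toAlgebra
  have hmap : ∀ p : k[X], algebraMap k[X] K p = aeval x p := fun _ => rfl
  have : IsScalarTower k k[X] K := IsScalarTower.of_algebraMap_eq fun c => by simp [hmap]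
  have : FaithfulSMul k[X] K :=
    (faithfulSMul_iff_algebraMap_injective _ _).mpr h.aeval_injective
  let : Algebra (FractionRing k[X]) K := FractionRing.liftAlgebra k[X] K
  have : IsScalarTower k[X] (FractionRing k[X]) K := inferInstance
  have hy : IsAlgebraic k[X] y :=
    ⟨X ^ 2 - C Q, (monic_X_pow_sub_C Q two_ne_zero).ne_zero, by simp [h.sq_eq, hmap]⟩
  have : Algebra.IsAlgebraic k[X] K := by
    refine ⟨fun z => ?_⟩
    obtain ⟨p, q, r, hr, e⟩ := h.exists_eq z
    rw [eq_div_of_mul_eq (h.aeval_ne_zero hr) e, div_eq_mul_inv]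
    exact ((isAlgebraic_algebraMap p).add ((isAlgebraic_algebraMap q).mul hy)).mul
      (isAlgebraic_algebraMap r).inv
  have : Algebra.IsAlgebraic (FractionRing k[X]) K :=
    (IsFractionRing.comap_isAlgebraic_iff (A := k[X])).mp this
  have : CharZero (FractionRing k[X]) :=
    charZero_of_injective_algebraMap (IsFractionRing.injective k[X] (FractionRing k[X]))
  -- k[X] → k(X) → K is a localization followed by a separable algebraic extension, hence formally
  -- étale. So the differentials of K are those of k[X] after base change, free on dx.
  have : Algebra.FormallyEtale (FractionRing k[X]) K := Algebra.FormallyEtale.of_isSeparable _ _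
  have : Algebra.FormallyEtale k[X] (FractionRing k[X]) :=
    Algebra.FormallyEtale.of_isLocalization (nonZeroDivisors k[X])
  have : Algebra.FormallyEtale k[X] K := Algebra.FormallyEtale.comp k[X] (FractionRing k[X]) K
  let e₁ : Ω[K⁄k] ≃ₗ[K] TensorProduct k[X] K Ω[k[X]⁄k] :=
    (KaehlerDifferential.tensorKaehlerEquivOfFormallyEtale k k[X] K).symm
  let e₂ : TensorProduct k[X] K Ω[k[X]⁄k] ≃ₗ[K] TensorProduct k[X] K k[X] :=
    (KaehlerDifferential.polynomialEquiv k).baseChange k[X] K _ _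
  let e₃ : TensorProduct k[X] K k[X] ≃ₗ[K] K := TensorProduct.AlgebraTensorModule.rid k[X] K K
  refine ⟨e₁ ≪≫ₗ e₂ ≪≫ₗ e₃, ?_⟩
  have hx : x = algebraMap k[X] K X := by simp [hmap]
  have h₁ : e₁ (KaehlerDifferential.D k K x) =
      TensorProduct.tmul k[X] 1 (KaehlerDifferential.D k k[X] X) := by
    rw [hx]
    exact KaehlerDifferential.tensorKaehlerEquivOfFormallyEtale_symm_D_algebraMap k k[X] K X
  rw [LinearEquiv.trans_apply, LinearEquiv.trans_apply, h₁]
  simp [e₂, e₃]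

/-- The isomorphism from the differentials to `K` that takes `dx / y` to `1`. -/
theorem exists_linearEquiv [CharZero k] (h : IsDoubleCover x y Q) :
    ∃ (e : Ω[K⁄k] ≃ₗ[K] K) (δ : Derivation k K K),
      (∀ z, e (KaehlerDifferential.D k K z) = δ z) ∧ δ x = y ∧
        2 * δ y = aeval x (derivative Q) := by
  obtain ⟨e₀, he₀⟩ := h.exists_linearEquiv_dx
  let e : Ω[K⁄k] ≃ₗ[K] K := e₀ ≪≫ₗ LinearEquiv.smulOfNeZero K K y h.y_ne_zero
  let δ : Derivation k K K := e.toLinearMap.compDer (KaehlerDifferential.D k K)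
  have hx : δ x = y := by
    change y • e₀ (KaehlerDifferential.D k K x) = y
    rw [he₀, smul_eq_mul, mul_one]
  refine ⟨e, δ, fun z => rfl, hx, ?_⟩
  have h1 := congrArg δ h.sq_eq
  rw [Derivation.leibniz_pow] at h1
  have h2 : δ (aeval x Q) = aeval x (derivative Q) * δ x := by
    simp
  rw [h2, hx] at h1
  refine mul_right_cancel₀ h.y_ne_zero ?_
  simpa [mul_comm, mul_assoc, mul_left_comm] using h1

end IsDoubleCover

/-! ### Regular differentials and the genus -/

namespace IsDoubleCover

variable {k K : Type*} [Field k] [Field K] [Algebra k K] {x y : K} {Q : k[X]}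

theorem derivation_add_mul (h : IsDoubleCover x y Q) {δ : Derivation k K K} (hx : δ x = y)
    (p q : k[X]) : δ (aeval x p + aeval x q * y) =
      aeval x p.derivative * y + (aeval x q.derivative * aeval x Q + aeval x q * δ y) := by
  rw [map_add, Derivation.leibniz, Derivation.map_aeval, Derivation.map_aeval, hx, ← h.sq_eq]
  simp only [smul_eq_mul]
  ring

/-- The form dx/y generates the regular differentials at a finite point. The derivation δ dual to it
preserves the local ring. Conversely, dx/y is y⁻¹ dx with y a unit if b ≠ 0, and 2 Q'(x)⁻¹ dy with
Q'(a) ≠ 0 if b = 0. -/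
theorem mem_regularDifferentials_iff [CharZero k] (h : IsDoubleCover x y Q)
    (hQ : ∀ a, Q.eval a = 0 → Q.derivative.eval a ≠ 0) {e : Ω[K⁄k] ≃ₗ[K] K}
    {δ : Derivation k K K} (he : ∀ z, e (KaehlerDifferential.D k K z) = δ z) (hx : δ x = y)
    (hy : 2 * δ y = aeval x (derivative Q)) {P : CurvePoint k K} {a b : k}
    (ha : P.HasValue x a) (hb : P.HasValue y b) (ω : Ω[K⁄k]) :
    ω ∈ P.regularDifferentials ↔ e ω ∈ P.ring := by
  have h2 : (2 : K) = algebraMap k K 2 := (map_ofNat (algebraMap k K) 2).symm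
  have h2' : (2 : K) ≠ 0 := by rw [h2]; simp
  have hδy : δ y ∈ P.ring := by
    have : δ y = algebraMap k K (1 / 2) * aeval x (derivative Q) := by
      rw [← hy]
      simp only [map_div₀, map_one, map_ofNat]
      field_simp
    rw [this]
    exact mul_mem (P.algebraMap_mem _) (CurvePoint.aeval_mem ha.mem _)
  have hpoly : ∀ p q : k[X], δ (aeval x p + aeval x q * y) ∈ P.ring := by
    intro p q
    have hm := fun p : k[X] => CurvePoint.aeval_mem ha.mem p
    rw [h.derivation_add_mul hx]
    exact add_mem (mul_mem (hm _) hb.mem)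
      (add_mem (mul_mem (hm _) (hm _)) (mul_mem (hm _) hδy))
  -- Quotient rule: if su is a polynomial in x and y and u is a unit, then u δs = δ(su) - s δu.
  have hδ : ∀ s ∈ P.ring, δ s ∈ P.ring := by
    intro s hs
    obtain ⟨p, q, u, hu, e⟩ := (h.mem_iff_exists hQ ha hb s).mp hs
    obtain ⟨p', q', rfl, -⟩ := id hu
    have hmem := sub_mem (hpoly p q) (mul_mem hs (hpoly p' q'))
    rw [← e, Derivation.leibniz, smul_eq_mul, smul_eq_mul, add_sub_cancel_left,
      ← ValuationSubring.valuation_le_one_iff, map_mul, hu.valuation_eq_one ha hb, one_mul,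
      ValuationSubring.valuation_le_one_iff] at hmem
    exact hmem
  constructor
  · intro hω
    induction hω using Submodule.span_induction with
    | mem ω hω =>
      obtain ⟨u, hu, s, hs, rfl⟩ := hω
      rw [map_smul, he, smul_eq_mul]
      exact mul_mem hu (hδ s hs)
    | zero => simp
    | add ω ω' _ _ h₁ h₂ => rw [map_add]; exact add_mem h₁ h₂
    | smul c ω _ h₁ =>
      rw [← algebraMap_smul K c ω, map_smul, smul_eq_mul]
      exact mul_mem (P.algebraMap_mem c) h₁
  · intro hω
    obtain rfl | hb0 := eq_or_ne b 0
    · have hQa : Q.eval a = 0 := by simpa using (h.sq_eq_of_hasValue ha hb).symm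
      have hval := ha.aeval (derivative Q)
      have hne : aeval x (derivative Q) ≠ 0 := by
        intro h0
        have := hval.valuation_eq_one (hQ a hQa)
        simp [h0] at this
      have hδ0 : δ y ≠ 0 := by
        intro h0
        simp [h0, hne.symm] at hy
      have e1 : ω = (e ω * (2 * (aeval x (derivative Q))⁻¹)) • KaehlerDifferential.D k K y := by
        apply e.injective
        rw [map_smul, he, smul_eq_mul, ← hy]
        field_simp
      rw [e1]
      refine Submodule.subset_span ⟨_, mul_mem hω (mul_mem ?_ (hval.inv (hQ a hQa)).mem), y,
        hb.mem, rfl⟩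
      rw [h2]
      exact P.algebraMap_mem 2
    · have e1 : ω = (e ω * y⁻¹) • KaehlerDifferential.D k K x := by
        apply e.injective
        rw [map_smul, he, smul_eq_mul, hx, inv_mul_cancel_right₀ h.y_ne_zero]
      rw [e1]
      exact Submodule.subset_span ⟨_, mul_mem hω (hb.inv hb0).mem, x, ha.mem, rfl⟩

section Infinity

variable {P : CurvePoint k K}

theorem valuation_aeval_lt (hP : P.HasPole x) {p r : k[X]} (hpr : p.degree < r.degree) :
    P.ring.valuation (aeval x p) < P.ring.valuation (aeval x r) := by
  have hX := CurvePoint.hasPole_iff.mp hP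
  have hr : r ≠ 0 := by rintro rfl; simp at hpr
  rw [valuation_aeval_of_hasPole hP hr]
  obtain rfl | hp := eq_or_ne p 0
  · rw [map_zero, map_zero]
    exact pow_pos (zero_lt_one.trans hX) _
  · rw [valuation_aeval_of_hasPole hP hp]
    exact pow_lt_pow_right₀ hX (natDegree_lt_natDegree hp hpr)

theorem valuation_derivative_mul_le (hP : P.HasPole x) (p : k[X]) :
    P.ring.valuation (aeval x p.derivative) * P.ring.valuation x ≤
      P.ring.valuation (aeval x p) := by
  have hX := CurvePoint.hasPole_iff.mp hP
  obtain h0 | h0 := eq_or_ne p.derivative 0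
  · simp [h0]
  have hp : p ≠ 0 := by rintro rfl; simp at h0
  have hd : p.natDegree ≠ 0 := by
    intro hd
    rw [natDegree_eq_zero] at hd
    obtain ⟨c, rfl⟩ := hd
    simp at h0
  rw [valuation_aeval_of_hasPole hP h0, valuation_aeval_of_hasPole hP hp, ← pow_succ]
  exact pow_le_pow_right₀ hX.le (natDegree_derivative_lt hd)

/-- Every function that is regular at infinity takes a value there. -/
theorem exists_hasValue_of_hasPole (h : IsDoubleCover x y Q) (hP : P.HasPole x) {s : K}
    (hs : s ∈ P.ring) : ∃ c, P.HasValue s c := by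
  have hX := CurvePoint.hasPole_iff.mp hP
  obtain ⟨p, q, r, hr, e⟩ := h.exists_eq s
  have hvr : P.ring.valuation (aeval x r) ≠ 0 := by simpa using h.aeval_ne_zero hr
  have hle : P.ring.valuation (aeval x p + aeval x q * y) ≤ P.ring.valuation (aeval x r) := by
    rw [← e, map_mul]
    exact mul_le_of_le_one_left' ((P.ring.valuation_le_one_iff _).mpr hs)
  rw [h.valuation_add_mul hP, max_le_iff] at hle
  have hdeg : p.natDegree ≤ r.natDegree := by
    obtain rfl | hp := eq_or_ne p 0
    · simp
    rw [valuation_aeval_of_hasPole hP hp, valuation_aeval_of_hasPole hP hr] at hle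
    exact (pow_le_pow_iff_right₀ hX).mp hle.1
  -- The value is the limit of p/r as x tends to infinity; it is 0 when deg p < deg r. By parity the
  -- term qy/r contributes nothing.
  refine ⟨p.coeff r.natDegree / r.leadingCoeff, ?_⟩
  set c := p.coeff r.natDegree / r.leadingCoeff with hc
  have e' : (s - algebraMap k K c) * aeval x r =
      aeval x (p - C c * r) + aeval x q * y := by
    simp only [map_sub, map_mul, aeval_C]
    linear_combination e
  have hlt : (p - C c * r).degree < r.degree := by
    rw [degree_eq_natDegree hr, degree_lt_iff_coeff_zero]
    intro n hn
    rw [coeff_sub, coeff_C_mul]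
    obtain rfl | hn := eq_or_lt_of_le hn
    · rw [coeff_natDegree, hc, div_mul_cancel₀ _ (leadingCoeff_ne_zero.mpr hr), sub_self]
    · rw [coeff_eq_zero_of_natDegree_lt (hdeg.trans_lt hn), coeff_eq_zero_of_natDegree_lt hn]
      simp
  have hqy : P.ring.valuation (aeval x q * y) < P.ring.valuation (aeval x r) := by
    refine lt_of_le_of_ne hle.2 fun heq => ?_
    obtain ⟨m, hm⟩ := h.odd
    obtain rfl | hq := eq_or_ne q 0
    · exact hvr (by simpa using heq.symm)
    rw [h.valuation_aeval_eq hP hm hr, h.valuation_aeval_mul_eq hP hm hq] at heq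
    have := h.zpow_param_injective hP hm heq
    omega
  have hfin := (Valuation.map_add_lt _ (valuation_aeval_lt hP hlt) hqy)
  rw [← e', map_mul] at hfin
  exact (mul_lt_iff_lt_one_left (zero_lt_iff.mpr hvr)).mp hfin

/-- This bounds the logarithmic derivative δs/s by y/x. It holds for polynomials in x and for y by a
degree count, then for p + qy because there is no cancellation, and for quotients by the Leibniz
rule. -/
theorem valuation_derivation_mul_le [CharZero k] (h : IsDoubleCover x y Q)
    {δ : Derivation k K K} (hx : δ x = y) (hy : 2 * δ y = aeval x (derivative Q))
    (hP : P.HasPole x) (s : K) :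
    P.ring.valuation (δ s) * P.ring.valuation x ≤ P.ring.valuation s * P.ring.valuation y := by
  have h2 : P.ring.valuation (2 : K) = 1 := by
    rw [← map_ofNat (algebraMap k K) 2, P.valuation_algebraMap two_ne_zero]
  have hδy : P.ring.valuation (δ y) * P.ring.valuation x ≤
      P.ring.valuation y * P.ring.valuation y := by
    rw [← one_mul (P.ring.valuation (δ y)), ← h2, ← map_mul, hy,
      ← map_mul P.ring.valuation y, ← pow_two, h.sq_eq]
    exact valuation_derivative_mul_le hP Q
  have hpoly : ∀ p q : k[X], P.ring.valuation (δ (aeval x p + aeval x q * y)) *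
      P.ring.valuation x ≤ P.ring.valuation (aeval x p + aeval x q * y) *
        P.ring.valuation y := by
    intro p q
    rw [h.derivation_add_mul hx, h.valuation_add_mul hP, ← map_mul, add_mul, add_mul]
    refine Valuation.map_add_le _ ?_ (Valuation.map_add_le _ ?_ ?_)
    · rw [mul_right_comm, map_mul, map_mul]
      exact mul_le_mul_left ((valuation_derivative_mul_le hP p).trans (le_max_left _ _)) _
    · rw [mul_right_comm, map_mul, map_mul, ← h.sq_eq, pow_two, map_mul, ← mul_assoc]
      refine mul_le_mul_left ((mul_le_mul_left (valuation_derivative_mul_le hP q) _).trans ?_) _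
      rw [← map_mul]
      exact le_max_right _ _
    · rw [mul_assoc, map_mul, map_mul]
      refine (mul_le_mul_right hδy _).trans ?_
      rw [← mul_assoc, ← map_mul]
      exact mul_le_mul_left (le_max_right _ _) _
  obtain ⟨p, q, r, hr, e⟩ := h.exists_eq s
  have hr0 : 0 < P.ring.valuation (aeval x r) := by
    simpa [zero_lt_iff] using h.aeval_ne_zero hr
  have hδ : δ s * x * aeval x r = δ (s * aeval x r) * x - s * (δ (aeval x r) * x) := by
    rw [Derivation.leibniz, smul_eq_mul, smul_eq_mul]
    ring
  rw [← mul_le_mul_iff_left₀ hr0, ← map_mul, ← map_mul, hδ]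
  refine Valuation.map_sub_le _ ?_ ?_
  · rw [map_mul, e, mul_right_comm, ← map_mul _ s, e]
    exact hpoly p q
  · rw [map_mul, map_mul, mul_assoc]
    refine mul_le_mul_right ?_ _
    have := hpoly r 0
    rw [map_zero, zero_mul, add_zero] at this
    rwa [mul_comm (P.ring.valuation y)]

/-- For t = x^m / y one has 2Q · x δt = x^m (2mQ - xQ'). The leading coefficient of 2mQ - XQ' is 2m
- (2m + 1) = -1 times that of Q, so no degree is lost. -/
theorem valuation_derivation_param [CharZero k] (h : IsDoubleCover x y Q)
    {δ : Derivation k K K} (hx : δ x = y) (hy : 2 * δ y = aeval x (derivative Q))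
    (hP : P.HasPole x) {m : ℕ} (hm : Q.natDegree = 2 * m + 1) :
    P.ring.valuation (δ (x ^ m / y)) * P.ring.valuation x = P.ring.valuation x ^ m := by
  have h2 : P.ring.valuation (2 : K) = 1 := by
    rw [← map_ofNat (algebraMap k K) 2, P.valuation_algebraMap two_ne_zero]
  have hx0 : x ≠ 0 := by
    have := h.aeval_ne_zero (X_ne_zero (R := k))
    rwa [aeval_X] at this
  let R : k[X] := C (2 * m : k) * Q - X * derivative Q
  have hcoeff : R.coeff (2 * m + 1) = -Q.leadingCoeff := by
    have hQc : Q.coeff (2 * m + 1) = Q.leadingCoeff := by rw [← hm, coeff_natDegree]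
    rw [coeff_sub, coeff_C_mul, coeff_X_mul, coeff_derivative, hQc]
    push_cast
    ring
  have hlc : R.coeff (2 * m + 1) ≠ 0 := by
    rw [hcoeff]
    exact neg_ne_zero.mpr (leadingCoeff_ne_zero.mpr h.poly_ne_zero)
  have hRd : R.natDegree = 2 * m + 1 := by
    refine natDegree_eq_of_le_of_coeff_ne_zero ?_ hlc
    refine (natDegree_sub_le _ _).trans (max_le ?_ ?_)
    · exact (natDegree_C_mul_le _ _).trans hm.le
    · refine natDegree_mul_le.trans ?_
      have := natDegree_derivative_le Q
      rw [natDegree_X]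
      omega
  have hR0 : R ≠ 0 := by
    intro h0
    simp [h0] at hlc
  have key : 2 * aeval x Q * (δ (x ^ m / y) * x) = x ^ m * aeval x R := by
    have h1 : δ (x ^ m / y * y) = δ (x ^ m) := by rw [div_mul_cancel₀ _ h.y_ne_zero]
    rw [Derivation.leibniz, Derivation.leibniz_pow, hx] at h1
    simp only [smul_eq_mul, nsmul_eq_mul] at h1
    have hxm : (m : K) * x ^ (m - 1) * x = m * x ^ m := by
      cases m with
      | zero => simp
      | succ m => rw [Nat.add_sub_cancel, pow_succ]; ring
    have h3 : x ^ m / y * y = x ^ m := div_mul_cancel₀ _ h.y_ne_zero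
    simp only [R, map_sub, map_mul, aeval_X, ← hy, ← h.sq_eq, map_ofNat, map_natCast]
    linear_combination (2 * y * x) * h1 - 2 * x * δ y * h3 + 2 * y ^ 2 * hxm
  have hv := congrArg P.ring.valuation key
  rw [map_mul, map_mul, h2, one_mul, map_mul, map_mul, map_pow, mul_comm,
    valuation_aeval_of_hasPole hP h.poly_ne_zero, valuation_aeval_of_hasPole hP hR0, hm, hRd] at hv
  refine mul_right_cancel₀ (pow_ne_zero (2 * m + 1) ?_) hv
  simpa using hx0

/-- The differential dt of the local parameter t = x^m / y generates the regular differentials, and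
its coefficient δt has the size of x^(m-1). The factor x on the left avoids the exponent m - 1. -/
theorem mem_regularDifferentials_iff_of_hasPole [CharZero k] (h : IsDoubleCover x y Q)
    {e : Ω[K⁄k] ≃ₗ[K] K} {δ : Derivation k K K}
    (he : ∀ z, e (KaehlerDifferential.D k K z) = δ z) (hx : δ x = y)
    (hy : 2 * δ y = aeval x (derivative Q)) (hP : P.HasPole x) {m : ℕ}
    (hm : Q.natDegree = 2 * m + 1) (ω : Ω[K⁄k]) :
    ω ∈ P.regularDifferentials ↔
      P.ring.valuation (e ω) * P.ring.valuation x ≤ P.ring.valuation x ^ m := by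
  have ht := h.isUniformizer_param hm hP
  have hparam := h.valuation_derivation_param hx hy hP hm
  have hX := CurvePoint.hasPole_iff.mp hP
  constructor
  · intro hω
    induction hω using Submodule.span_induction with
    | mem ω hω =>
      obtain ⟨u, hu, s, hs, rfl⟩ := hω
      rw [map_smul, he, smul_eq_mul, map_mul, mul_assoc]
      refine (mul_le_of_le_one_left' ((P.ring.valuation_le_one_iff _).mpr hu)).trans ?_
      obtain ⟨c, hc⟩ := h.exists_hasValue_of_hasPole hP hs
      have hs' : δ s = δ (s - algebraMap k K c) := by
        -- Subtracting the value of s does not change δs and puts s - c in the maximal ideal, where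
        -- its valuation is at most that of t.
        rw [map_sub, Derivation.map_algebraMap, sub_zero]
      rw [hs']
      refine (h.valuation_derivation_mul_le hx hy hP _).trans ?_
      refine (mul_le_mul_left (ht.valuation_le_of_lt_one hc) _).trans ?_
      rw [← map_mul, div_mul_cancel₀ _ h.y_ne_zero, map_pow]
    | zero => simp
    | add ω ω' _ _ h₁ h₂ =>
      rw [← map_mul] at h₁ h₂ ⊢
      rw [map_add, add_mul]
      exact Valuation.map_add_le _ h₁ h₂
    | smul c ω _ h₁ =>
      rw [← algebraMap_smul K c ω, map_smul, smul_eq_mul, map_mul, mul_assoc]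
      exact (mul_le_of_le_one_left' (P.valuation_algebraMap_le c)).trans h₁
  · intro hω
    have hX0 : 0 < P.ring.valuation x := zero_lt_one.trans hX
    have hδ0 : δ (x ^ m / y) ≠ 0 := by
      intro h0
      rw [h0, map_zero, zero_mul] at hparam
      exact (pow_pos hX0 m).ne hparam
    have e1 : ω = (e ω / δ (x ^ m / y)) • KaehlerDifferential.D k K (x ^ m / y) := by
      apply e.injective
      rw [map_smul, he, smul_eq_mul, div_mul_cancel₀ _ hδ0]
    rw [e1]
    refine Submodule.subset_span ⟨_, ?_, _, ht.mem, rfl⟩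
    rw [← hparam, mul_le_mul_iff_left₀ hX0] at hω
    rw [← P.ring.valuation_le_one_iff, map_div₀]
    exact div_le_one_of_le₀ hω zero_le

end Infinity

/-- A function that is regular at all finite points is a polynomial in `x` and `y`. -/
theorem exists_eq_add_mul_of_forall_mem [IsAlgClosed k] [CharZero k] (h : IsDoubleCover x y Q)
    (hQ : ∀ a, Q.eval a = 0 → Q.derivative.eval a ≠ 0) {z : K}
    (hz : ∀ (P : CurvePoint k K) (a b : k), P.HasValue x a → P.HasValue y b → z ∈ P.ring) :
    ∃ p q : k[X], z = aeval x p + aeval x q * y := by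
  have key : ∀ (n : ℕ) (p q r : k[X]), r ≠ 0 → r.natDegree = n →
      z * aeval x r = aeval x p + aeval x q * y → ∃ p q : k[X], z = aeval x p + aeval x q * y := by
    intro n
    induction n with
    | zero =>
      intro p q r hr hd e
      rw [natDegree_eq_zero] at hd
      obtain ⟨c, rfl⟩ := hd
      have hc : algebraMap k K c ≠ 0 := by simpa using hr
      refine ⟨C c⁻¹ * p, C c⁻¹ * q, ?_⟩
      rw [aeval_C] at e
      rw [map_mul, map_mul, aeval_C, mul_assoc, ← mul_add, ← e, map_inv₀]
      field_simp
    | succ n ih =>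
      intro p q r hr hd e
      -- The denominator is removed one root at a time: regularity of z above a root a of r forces p
      -- and q to vanish at a.
      obtain ⟨a, ha⟩ := IsAlgClosed.exists_root r (by
        rw [degree_eq_natDegree hr, hd]
        exact_mod_cast n.succ_ne_zero)
      obtain ⟨r₁, rfl⟩ := dvd_iff_isRoot.mpr ha
      obtain ⟨b, hb⟩ := IsAlgClosed.exists_pow_nat_eq (Q.eval a) two_pos
      have hval : ∀ b : k, b ^ 2 = Q.eval a → p.eval a + q.eval a * b = 0 := by
        intro b hb
        obtain ⟨P, hx, hy⟩ := h.exists_hasValue hb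
        refine ((hx.aeval p).add ((hx.aeval q).mul hy)).unique ?_
        rw [← e, CurvePoint.hasValue_zero_iff, map_mul]
        have hzP := (P.ring.valuation_le_one_iff _).mpr (hz P a b hx hy)
        refine (mul_le_of_le_one_left' hzP).trans_lt ?_
        rw [← CurvePoint.hasValue_zero_iff]
        have := hx.aeval ((X - C a) * r₁)
        rwa [eval_mul, eval_sub, eval_X, eval_C, sub_self, zero_mul] at this
      have hp : p.eval a = 0 := by
        have h1 := hval b hb
        have h2 := hval (-b) (by rw [neg_sq, hb])
        have : 2 * p.eval a = 0 := by linear_combination h1 + h2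
        exact (mul_eq_zero.mp this).resolve_left two_ne_zero
      have hq : q.eval a = 0 := by
        obtain rfl | hb0 := eq_or_ne b 0
        · have hQa : Q.eval a = 0 := by simpa using hb.symm
          obtain ⟨p₁, rfl⟩ := dvd_iff_isRoot.mpr hp
          obtain ⟨Q₁, hQ₁⟩ := dvd_iff_isRoot.mpr hQa
          have hQ₁a : Q₁.eval a ≠ 0 := by
            have := hQ a hQa
            rw [hQ₁] at this
            simpa [derivative_mul] using this
          obtain ⟨P, hx, hy⟩ := h.exists_hasValue hb
          have hQv := (hx.aeval Q₁).valuation_eq_one hQ₁a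
          have hy0 : 0 < P.ring.valuation y := by simpa [zero_lt_iff] using h.y_ne_zero
          have hsq : aeval x (X - C a) * aeval x Q₁ = y * y := by
            rw [← map_mul, ← hQ₁, ← h.sq_eq, pow_two]
          -- At a branch point the value of p + qy does not see q(a). Instead, q y = (x - a)(z r₁ -
          -- p₁) together with (x - a)Q₁ = y² gives qQ₁ = (z r₁ - p₁)y, which vanishes there.
          have e' : aeval x q * aeval x Q₁ * y =
              (z * aeval x r₁ - aeval x p₁) * y * y := by
            rw [map_mul, map_mul] at e
            linear_combination (z * aeval x r₁ - aeval x p₁) * hsq - aeval x Q₁ * e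
          have e'' := mul_right_cancel₀ h.y_ne_zero e'
          refine (hx.aeval q).unique ?_
          rw [CurvePoint.hasValue_zero_iff]
          have hv := congrArg P.ring.valuation e''
          rw [map_mul, hQv, mul_one, map_mul] at hv
          rw [hv]
          refine (mul_le_of_le_one_left' ((P.ring.valuation_le_one_iff _).mpr ?_)).trans_lt
            (CurvePoint.hasValue_zero_iff.mp hy)
          exact sub_mem (mul_mem (hz P a 0 hx hy) (CurvePoint.aeval_mem hx.mem _))
            (CurvePoint.aeval_mem hx.mem _)
        · have h1 := hval b hb
          rw [hp, zero_add] at h1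
          exact (mul_eq_zero.mp h1).resolve_right hb0
      obtain ⟨p₁, rfl⟩ := dvd_iff_isRoot.mpr hp
      obtain ⟨q₁, rfl⟩ := dvd_iff_isRoot.mpr hq
      have hr₁ : r₁ ≠ 0 := right_ne_zero_of_mul hr
      refine ih p₁ q₁ r₁ hr₁ ?_ ?_
      · rw [natDegree_mul (X_sub_C_ne_zero a) hr₁, natDegree_X_sub_C] at hd
        omega
      · refine mul_left_cancel₀ (h.aeval_ne_zero (X_sub_C_ne_zero a)) ?_
        simp only [map_mul] at e
        linear_combination e
  obtain ⟨p, q, r, hr, e⟩ := h.exists_eq z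
  exact key _ p q r hr rfl e

/-- The genus of the curve `y² = Q(x)` with `Q` separable of degree `2 m + 1`. -/
theorem curveGenus_eq [IsAlgClosed k] [CharZero k] (h : IsDoubleCover x y Q)
    (hQ : ∀ a, Q.eval a = 0 → Q.derivative.eval a ≠ 0) {m : ℕ} (hm : Q.natDegree = 2 * m + 1) :
    curveGenus k K = m := by
  obtain ⟨e, δ, he, hx, hy⟩ := h.exists_linearEquiv
  let φ : k[X] →ₗ[k] Ω[K⁄k] :=
    (e.symm.restrictScalars k).toLinearMap ∘ₗ (aeval (R := k) x).toLinearMap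
  have hφ : ∀ p, e (φ p) = aeval x p := fun p => e.apply_symm_apply _
  have hinj : Function.Injective φ := fun p q hpq => h.aeval_injective (by
    rw [← hφ, ← hφ, hpq])
  have hglobal : (⨅ P : CurvePoint k K, P.regularDifferentials : Submodule k (Ω[K⁄k])) =
      (degreeLT k m).map φ := by
    ext ω
    rw [Submodule.mem_iInf, Submodule.mem_map]
    constructor
    · intro hω
      obtain ⟨p, q, e₁⟩ := h.exists_eq_add_mul_of_forall_mem hQ (z := e ω) fun P a b ha hb =>
        (h.mem_regularDifferentials_iff hQ he hx hy ha hb ω).mp (hω P)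
      obtain ⟨P, hP⟩ := h.exists_hasPole
      have hX := CurvePoint.hasPole_iff.mp hP
      have hinf := (h.mem_regularDifferentials_iff_of_hasPole he hx hy hP hm ω).mp (hω P)
      rw [e₁, h.valuation_add_mul hP] at hinf
      -- If q ≠ 0, then xy would be at most x^m in size. Squaring gives 2m + 3 ≤ 2m.
      have hq : q = 0 := by
        by_contra hq
        have hle := (mul_le_mul_left (le_max_right (P.ring.valuation (aeval x p)) _) _).trans hinf
        rw [map_mul, valuation_aeval_of_hasPole hP hq, mul_assoc] at hle
        have hle' : P.ring.valuation y * P.ring.valuation x ≤ P.ring.valuation x ^ m :=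
          (le_mul_of_one_le_left' (one_le_pow₀ hX.le)).trans hle
        have hsq := pow_le_pow_left₀ zero_le hle' 2
        rw [mul_pow, h.valuation_y_sq hP, hm, ← pow_add, ← pow_mul,
          pow_le_pow_iff_right₀ hX] at hsq
        omega
      subst hq
      refine ⟨p, ?_, e.injective (by rw [hφ, e₁]; simp)⟩
      obtain rfl | hp := eq_or_ne p 0
      · exact zero_mem _
      have hle := (mul_le_mul_left (le_max_left _ _) _).trans hinf
      rw [valuation_aeval_of_hasPole hP hp, ← pow_succ, pow_le_pow_iff_right₀ hX] at hle
      rw [mem_degreeLT, degree_eq_natDegree hp]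
      exact_mod_cast hle
    · rintro ⟨p, hp, rfl⟩ P
      obtain hP | ⟨a, b, ha, hb⟩ := h.hasValue_or_hasPole P
      · have hX := CurvePoint.hasPole_iff.mp hP
        rw [h.mem_regularDifferentials_iff_of_hasPole he hx hy hP hm, hφ]
        obtain rfl | hp0 := eq_or_ne p 0
        · simp
        rw [mem_degreeLT, degree_eq_natDegree hp0] at hp
        rw [valuation_aeval_of_hasPole hP hp0, ← pow_succ, pow_le_pow_iff_right₀ hX]
        exact_mod_cast hp
      · rw [h.mem_regularDifferentials_iff hQ he hx hy ha hb, hφ]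
        exact CurvePoint.aeval_mem ha.mem p
  rw [curveGenus, hglobal, ((degreeLT k m).equivMapOfInjective φ hinj).symm.finrank_eq,
    (degreeLTEquiv k m).finrank_eq, Module.finrank_fin_fun]

end IsDoubleCover

/-! ### Recognizing double covers; degrees of extensions -/

theorem isDoubleCover_of_isFractionRing {k K : Type*} [Field k] [Field K] [Algebra k K]
    {F : k[X][X]} [Algebra (AdjoinRoot F) K] [IsFractionRing (AdjoinRoot F) K]
    [IsScalarTower k (AdjoinRoot F) K] {Q : k[X]} (hodd : Odd Q.natDegree)
    (hinj : Function.Injective (AdjoinRoot.of F))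
    (hroot : AdjoinRoot.root F ^ 2 = AdjoinRoot.of F Q) :
    IsDoubleCover (algebraMap (AdjoinRoot F) K (AdjoinRoot.of F X))
      (algebraMap (AdjoinRoot F) K (AdjoinRoot.root F)) Q := by
  set x := algebraMap (AdjoinRoot F) K (AdjoinRoot.of F X) with hx
  set y := algebraMap (AdjoinRoot F) K (AdjoinRoot.root F) with hy
  have haeval : ∀ p : k[X], aeval x p = algebraMap (AdjoinRoot F) K (AdjoinRoot.of F p) := by
    intro p
    induction p using Polynomial.induction_on' with
    | add p q hp hq => simp only [map_add, hp, hq]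
    | monomial n c =>
      rw [aeval_monomial, ← C_mul_X_pow_eq_monomial, map_mul, map_pow, map_mul, map_pow, ← hx,
        IsScalarTower.algebraMap_apply k (AdjoinRoot F) K]
      rfl
  have htr : ∀ p : k[X], aeval x p = 0 → p = 0 := by
    intro p hp
    rw [haeval] at hp
    exact hinj (IsFractionRing.injective (AdjoinRoot F) K (by rw [hp, map_zero, map_zero]))
  have hsq : y ^ 2 = aeval x Q := by rw [haeval, ← hroot, map_pow]
  have hQ0 : Q ≠ 0 := by rintro rfl; simp at hodd
  have hrep : ∀ r : AdjoinRoot F, ∃ p q : k[X],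
      algebraMap (AdjoinRoot F) K r = aeval x p + aeval x q * y := by
    intro r
    obtain ⟨p, q, rfl⟩ := AdjoinRoot.exists_eq_of_add_of_mul_root hroot r
    exact ⟨p, q, by rw [map_add, map_mul, haeval, haeval]⟩
  refine ⟨fun ⟨p, hp, h0⟩ => hp (htr p h0), hsq, hodd, fun z => ?_⟩
  obtain ⟨n, d, hd, rfl⟩ := IsFractionRing.div_surjective (A := AdjoinRoot F) z
  have : Nontrivial (AdjoinRoot F) := hinj.nontrivial
  have hd0 : algebraMap (AdjoinRoot F) K d ≠ 0 :=
    IsFractionRing.to_map_ne_zero_of_mem_nonZeroDivisors hd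
  obtain ⟨p, q, e⟩ := hrep n
  obtain ⟨p', q', e'⟩ := hrep d
  -- Rationalize the denominator: multiply (p + qy)/(p' + q'y) above and below by p' - q'y.
  refine ⟨p * p' - q * q' * Q, q * p' - p * q', p' ^ 2 - q' ^ 2 * Q, ?_, ?_⟩
  · intro h0
    have hq : q' = 0 := by
      by_contra hq
      have h1 := congrArg natDegree (sub_eq_zero.mp h0)
      rw [natDegree_pow, natDegree_mul (pow_ne_zero 2 hq) hQ0, natDegree_pow] at h1
      grind
    subst hq
    have hp : p' = 0 := by simpa using h0
    subst hp
    exact hd0 (by simp [e'])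
  · rw [div_mul_eq_mul_div, div_eq_iff hd0, e, e']
    simp only [map_sub, map_mul, map_pow, ← hsq]
    ring

namespace IsDoubleCover

open IntermediateField

variable {k K : Type*} [Field k] [Field K] [Algebra k K] {x y : K} {Q : k[X]}

/-- K is generated over k(x) by y, a root of a monic quadratic, and y is not in k(x) because 1 and y
are independent over k[x]. -/
theorem finrank_adjoin (h : IsDoubleCover x y Q) : Module.finrank k⟮x⟯ K = 2 := by
  have hmem : ∀ p : k[X], aeval x p ∈ k⟮x⟯ := fun p =>
    IntermediateField.algebra_adjoin_le_adjoin _ _ (aeval_mem_adjoin_singleton _ _)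
  have htop : k⟮x⟯⟮y⟯ = ⊤ := by
    refine top_unique fun z _ => ?_
    obtain ⟨p, q, r, hr, e⟩ := h.exists_eq z
    rw [eq_div_of_mul_eq (h.aeval_ne_zero hr) e]
    have hm : ∀ p : k[X], aeval x p ∈ k⟮x⟯⟮y⟯ := fun p =>
      (k⟮x⟯⟮y⟯).algebraMap_mem ⟨_, hmem p⟩
    exact div_mem (add_mem (hm p) (mul_mem (hm q) (mem_adjoin_simple_self _ y))) (hm r)
  let c : k⟮x⟯ := ⟨aeval x Q, hmem Q⟩
  have hroot : aeval y (X ^ 2 - C c : k⟮x⟯[X]) = 0 := by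
    simp only [map_sub, map_pow, aeval_X, aeval_C, h.sq_eq]
    exact sub_self _
  have hmonic : (X ^ 2 - C c : k⟮x⟯[X]).Monic := monic_X_pow_sub_C c two_ne_zero
  have hint : IsIntegral k⟮x⟯ y := ⟨_, hmonic, hroot⟩
  have hfin : Module.finrank k⟮x⟯ k⟮x⟯⟮y⟯ = (minpoly k⟮x⟯ y).natDegree := adjoin.finrank hint
  rw [htop, finrank_top'] at hfin
  rw [hfin]
  refine le_antisymm ?_ ?_
  · have := natDegree_le_of_dvd (minpoly.dvd _ _ hroot) hmonic.ne_zero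
    rwa [natDegree_X_pow_sub_C] at this
  · rw [minpoly.two_le_natDegree_iff hint]
    rintro ⟨⟨w, hw⟩, hwy⟩
    change w = y at hwy
    subst hwy
    rw [mem_adjoin_simple_iff] at hw
    obtain ⟨r, s, e⟩ := hw
    obtain h0 | h0 := eq_or_ne (aeval x s) 0
    · rw [h0, div_zero] at e
      exact h.y_ne_zero e
    have h1 := h.add_mul_eq_zero (p := -r) (q := s) (by
      rw [eq_div_iff h0] at e
      rw [map_neg]
      linear_combination e)
    rw [h1.2, map_zero] at h0
    exact h0 rfl

end IsDoubleCover

/-- The degree of `k(x)` over `k(p(x) / q(x))`. -/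
theorem relfinrank_adjoin_div {k K : Type*} [Field k] [Field K] [Algebra k K] {x : K}
    (hx : Transcendental k x) {p q : k[X]} (hpq : IsCoprime p q)
    (hdeg : q.natDegree < p.natDegree) :
    IntermediateField.relfinrank (IntermediateField.adjoin k {aeval x p / aeval x q})
      (IntermediateField.adjoin k {x}) = p.natDegree := by
  have hinj : Function.Injective (aeval (R := k) x) := transcendental_iff_injective.mp hx
  let ψ : RatFunc k →ₐ[k] K := IsFractionRing.liftAlgHom (K := RatFunc k) hinj
  have hψ : ∀ r : k[X], ψ (algebraMap k[X] (RatFunc k) r) = aeval x r := fun r =>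
    IsFractionRing.lift_algebraMap hinj r
  let f : RatFunc k := algebraMap k[X] _ p / algebraMap k[X] _ q
  have hf : ψ f = aeval x p / aeval x q := by rw [map_div₀, hψ, hψ]
  have hX : ψ RatFunc.X = x := by rw [← RatFunc.algebraMap_X, hψ, aeval_X]
  have hp0 : p ≠ 0 := by rintro rfl; simp at hdeg
  have hq0 : q ≠ 0 := by
    rintro rfl
    rw [isCoprime_zero_right] at hpq
    rw [natDegree_eq_zero_of_isUnit hpq] at hdeg
    simp at hdeg
  have h1 : IntermediateField.adjoin k {aeval x p / aeval x q} =
      (IntermediateField.adjoin k {f}).map ψ := by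
    rw [IntermediateField.adjoin_map, Set.image_singleton, hf]
  have h2 : IntermediateField.adjoin k {x} = (⊤ : IntermediateField k (RatFunc k)).map ψ := by
    rw [← RatFunc.adjoin_X, IntermediateField.adjoin_map, Set.image_singleton, hX]
  have hnum : f.num.natDegree = p.natDegree := by
    have hd : f.num ∣ p := RatFunc.num_div_dvd p hq0
    have hd' : p ∣ f.num := by
      refine hpq.dvd_of_dvd_mul_right (y := f.num) (z := q) ⟨f.denom, ?_⟩
      apply IsFractionRing.injective k[X] (RatFunc k)
      have := RatFunc.num_div_denom f
      rw [map_mul, map_mul]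
      rw [div_eq_div_iff (RatFunc.algebraMap_ne_zero f.denom_ne_zero)
        (RatFunc.algebraMap_ne_zero hq0)] at this
      exact this
    exact le_antisymm (natDegree_le_of_dvd hd hp0)
      (natDegree_le_of_dvd hd' (fun h0 => hp0 (by rw [h0] at hd; exact zero_dvd_iff.mp hd)))
  have hden : f.denom.natDegree ≤ q.natDegree :=
    natDegree_le_of_dvd (RatFunc.denom_div_dvd p q) hq0
  rw [h1, h2, IntermediateField.relfinrank_map_map, IntermediateField.relfinrank_top_right,
    RatFunc.finrank_eq_max_natDegree, hnum]
  omega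

/-! ### The numerators and denominators of `g` and `h` -/

namespace Cover

open CoverCoeff

noncomputable def numG : ℂ[X] :=
  X ^ 5 + C a₄ * X ^ 4 + C a₃ * X ^ 3 + C a₂ * X ^ 2 + C a₁ * X + C a₀

noncomputable def denG : ℂ[X] := C b₂ * X ^ 2 + C b₁ * X

noncomputable def numH : ℂ[X] :=
  X ^ 6 + C c₅ * X ^ 5 + C c₄ * X ^ 4 + C c₃ * X ^ 3 + C c₂ * X ^ 2 + C c₁ * X + C c₀

noncomputable def denH : ℂ[X] := C d * X ^ 2 * (X - C (2 * kappa)) ^ 2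

/-- The polynomial `Q` such that `C` is the curve `y² = Q(x)`. -/
noncomputable def polyC : ℂ[X] := C (-sqrt5)⁻¹ * quinticC

/-- The unit `9 + 4 √5`. -/
noncomputable def ε : ℂ := 9 + 4 * sqrt5

variable {K : Type*} [Field K] [Algebra ℂ K]

theorem coverG_eq (x : K) : coverG x = aeval x numG / aeval x denG := rfl

theorem coverH_eq (x : K) : coverH x = aeval x numH / aeval x denH := rfl

theorem sqrt5_sq : sqrt5 ^ 2 = 5 := by
  rw [sqrt5, ← Complex.ofReal_pow, Real.sq_sqrt (by norm_num)]
  norm_num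

theorem eps_mul : ε * (9 - 4 * sqrt5) = 1 := by
  rw [ε]; linear_combination (-16) * sqrt5_sq

theorem eps_ne_zero : ε ≠ 0 := left_ne_zero_of_mul_eq_one eps_mul

theorem eps_sq : ε ^ 2 = 161 + 72 * sqrt5 := by
  rw [ε]; linear_combination 16 * sqrt5_sq

theorem eps_pow_three : ε ^ 3 = 2889 + 1292 * sqrt5 := by
  rw [pow_succ, eps_sq, ε]; linear_combination 288 * sqrt5_sq

theorem eps_pow_four : ε ^ 4 = 51841 + 23184 * sqrt5 := by
  rw [pow_succ, eps_pow_three, ε]; linear_combination (4 * 1292) * sqrt5_sq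

theorem eps_pow_five : ε ^ 5 = 930249 + 416020 * sqrt5 := by
  rw [pow_succ, eps_pow_four, ε]; linear_combination (4 * 23184) * sqrt5_sq

theorem eps_pow_six : ε ^ 6 = 16692641 + 7465176 * sqrt5 := by
  rw [pow_succ, eps_pow_five, ε]; linear_combination (4 * 416020) * sqrt5_sq

theorem kappa_eq : kappa = 9 * ε := by
  rw [kappa, ε]; ring

/-- ε is the sixth power of the golden ratio, and 219602 + 98209√5 is its 27th power, a square root
of ε⁹. Only d² enters the equation of E. -/
theorem d_sq : d ^ 2 = 5000000 * ε ^ 9 := by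
  have h : ε ^ 9 = (219602 + 98209 * sqrt5) ^ 2 := by
    rw [show ε ^ 9 = ε ^ 4 * ε ^ 5 by ring, eps_pow_four, eps_pow_five]
    linear_combination (23184 * 416020 - 98209 ^ 2) * sqrt5_sq
  rw [h, d]
  linear_combination (1000000 * (219602 + 98209 * sqrt5) ^ 2) * sqrt5_sq

theorem d_ne_zero : d ≠ 0 := by
  intro h
  have := d_sq
  rw [h] at this
  simp [eps_ne_zero] at this

theorem b₂_eq : b₂ = -100 * sqrt5 * ε ^ 3 := by rw [b₂, eps_pow_three]

theorem b₁_eq : b₁ = 1800 * sqrt5 * ε ^ 4 := by rw [b₁, eps_pow_four]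

theorem b₂_ne_zero : b₂ ≠ 0 := by
  rw [b₂_eq]
  exact mul_ne_zero (mul_ne_zero (by norm_num) sqrt5_ne_zero) (pow_ne_zero _ eps_ne_zero)

theorem denG_eq : denG = C b₂ * (X * (X - C (2 * kappa))) := by
  rw [denG, b₁_eq, b₂_eq, kappa_eq]
  simp only [map_mul, map_pow, map_neg, map_ofNat]
  ring

theorem numG_eq : numG = X ^ 5 - 45 * C ε * X ^ 4 + 660 * C ε ^ 2 * X ^ 3 -
    3240 * C ε ^ 3 * X ^ 2 + 1980 * C ε ^ 4 * X - 324 * C ε ^ 5 := by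
  rw [numG, a₄, a₃, a₂, a₁, a₀, ← eps_sq, ← eps_pow_three, ← eps_pow_four, ← eps_pow_five, ← ε]
  simp only [map_mul, map_pow, map_neg, map_ofNat]
  ring

theorem numH_eq : numH = X ^ 6 - 54 * C ε * X ^ 5 + 1030 * C ε ^ 2 * X ^ 4 -
    7920 * C ε ^ 3 * X ^ 3 + 18780 * C ε ^ 4 * X ^ 2 + 216 * C ε ^ 5 * X - 1944 * C ε ^ 6 := by
  rw [numH, c₅, c₄, c₃, c₂, c₁, c₀, ← eps_sq, ← eps_pow_three, ← eps_pow_four, ← eps_pow_five,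
    ← eps_pow_six, ← ε]
  simp only [map_mul, map_pow, map_neg, map_ofNat]
  ring

/-- The roots 1 and 2κ - 1 have sum 18ε and product 18ε - 1 = ε², so their quadratic factor is
homogeneous in X and ε. -/
theorem quinticC_eq : quinticC = X * (X - 18 * C ε) * ((X - 9 * C ε) *
    (X ^ 2 - 18 * C ε * X + C ε ^ 2)) := by
  have h : (C ε : ℂ[X]) ^ 2 = 18 * C ε - 1 := by
    rw [← map_pow, show ε ^ 2 = 18 * ε - 1 by rw [eps_sq, ε]; ring]
    simp only [map_sub, map_mul, map_ofNat, map_one]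
  rw [quinticC, kappa_eq]
  simp only [map_sub, map_mul, map_ofNat, map_one]
  linear_combination (-X * (X - 18 * C ε) * (X - 9 * C ε)) * h

/-! In the coordinate `w = x / ε - 9` the coefficients are rational. -/

section Coordinate

variable (w : K)

theorem aeval_numG : aeval (algebraMap ℂ K ε * (w + 9)) numG =
    algebraMap ℂ K ε ^ 5 * (w * (w ^ 2 - 75) ^ 2) := by
  simp only [numG_eq, map_add, map_sub, map_mul, map_pow, aeval_X, aeval_C, map_ofNat]
  ring

theorem aeval_denG : aeval (algebraMap ℂ K ε * (w + 9)) denG =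
    algebraMap ℂ K ε ^ 5 * (-100 * algebraMap ℂ K sqrt5 * (w ^ 2 - 81)) := by
  rw [denG_eq, b₂_eq, kappa_eq]
  simp only [map_sub, map_mul, map_pow, aeval_X, aeval_C, map_ofNat, map_neg]
  ring

theorem aeval_numH : aeval (algebraMap ℂ K ε * (w + 9)) numH =
    algebraMap ℂ K ε ^ 6 * ((w ^ 2 - 75) * (w ^ 4 - 110 * w ^ 2 + 2025)) := by
  simp only [numH_eq, map_add, map_sub, map_mul, map_pow, aeval_X, aeval_C, map_ofNat]
  ring

theorem aeval_denH : aeval (algebraMap ℂ K ε * (w + 9)) denH =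
    algebraMap ℂ K d * (algebraMap ℂ K ε ^ 4 * (w ^ 2 - 81) ^ 2) := by
  rw [denH, kappa_eq]
  simp only [map_sub, map_mul, map_pow, aeval_X, aeval_C, map_ofNat]
  ring

theorem aeval_polyC : aeval (algebraMap ℂ K ε * (w + 9)) polyC =
    -(algebraMap ℂ K sqrt5)⁻¹ *
      (algebraMap ℂ K ε ^ 5 * (w * (w ^ 2 - 81) * (w ^ 2 - 80))) := by
  rw [polyC, quinticC_eq]
  simp only [map_add, map_sub, map_mul, map_pow, aeval_X, aeval_C, map_ofNat, map_inv₀, map_neg,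
    inv_neg]
  ring

end Coordinate

theorem exists_coordinate (x : K) : ∃ w : K, x = algebraMap ℂ K ε * (w + 9) := by
  have : algebraMap ℂ K ε ≠ 0 := by simpa using eps_ne_zero
  exact ⟨x / algebraMap ℂ K ε - 9, by field_simp; ring⟩

/-- The point `(g x, h x * y)` lies on `E` if `(x, y)` lies on `C`. -/
theorem coverH_sq_mul {x : K} (hx : aeval x denG ≠ 0) :
    coverH x ^ 2 * aeval x polyC = coverG x ^ 3 - coverG x := by
  obtain ⟨w, rfl⟩ := exists_coordinate x
  rw [coverG_eq, coverH_eq, aeval_numG, aeval_numH, aeval_denH, aeval_polyC]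
  rw [aeval_denG] at hx ⊢
  have hs : algebraMap ℂ K sqrt5 ^ 2 = 5 := by rw [← map_pow, sqrt5_sq, map_ofNat]
  have hd : algebraMap ℂ K d ^ 2 = 5000000 * algebraMap ℂ K ε ^ 9 := by
    rw [← map_pow, d_sq, map_mul, map_pow, map_ofNat]
  have he0 : algebraMap ℂ K ε ≠ 0 := by simpa using eps_ne_zero
  have hs0 : algebraMap ℂ K sqrt5 ≠ 0 := by simpa using sqrt5_ne_zero
  have h5 : (5000000 : K) ≠ 0 := by
    rw [← map_ofNat (algebraMap ℂ K)]; simp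
  have h100 : (100 : K) ≠ 0 := by
    rw [← map_ofNat (algebraMap ℂ K)]; simp
  have hw : w ^ 2 - 81 ≠ 0 := right_ne_zero_of_mul (right_ne_zero_of_mul hx)
  generalize algebraMap ℂ K ε = e at *
  generalize algebraMap ℂ K sqrt5 = s at *
  generalize algebraMap ℂ K d = δ at *
  -- Once the powers of ε cancel and √5² = 5 is used, what remains is u(u - 75)⁴ - 50000(u - 81)² =
  -- (u - 80)(u² - 110u + 2025)² for u = w².
  rw [div_pow, mul_pow δ, hd]
  have h1 : (e ^ 6 * ((w ^ 2 - 75) * (w ^ 4 - 110 * w ^ 2 + 2025))) ^ 2 /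
      (5000000 * e ^ 9 * (e ^ 4 * (w ^ 2 - 81) ^ 2) ^ 2) *
      (-s⁻¹ * (e ^ 5 * (w * (w ^ 2 - 81) * (w ^ 2 - 80)))) =
      -(s⁻¹ / 5000000) * (((w ^ 2 - 75) * (w ^ 4 - 110 * w ^ 2 + 2025)) ^ 2 *
        (w * (w ^ 2 - 80)) / (w ^ 2 - 81) ^ 3) := by
    field_simp
  have h2 : e ^ 5 * (w * (w ^ 2 - 75) ^ 2) / (e ^ 5 * (-100 * s * (w ^ 2 - 81))) =
      -(w * (w ^ 2 - 75) ^ 2 / (100 * s * (w ^ 2 - 81))) := by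
    field_simp
  rw [h1, h2]
  field_simp
  rw [hs]
  ring

end Cover

/-! ### Separability, non-vanishing and degrees -/

namespace Cover

open CoverCoeff

variable {K : Type*} [Field K] [Algebra ℂ K]

/-- The left side is the numerator of g', and `denG ^ 2` is a constant times `denH`. So g' is a
constant multiple of h, and the critical points of g are zeros of `numH`. -/
theorem derivative_mul_sub : derivative numG * denG - numG * derivative denG =
    C (-300 * sqrt5 * ε ^ 3) * numH := by
  rw [denG_eq, b₂_eq, kappa_eq, numG_eq, numH_eq]
  simp only [derivative_mul, derivative_sub, derivative_add, derivative_X, derivative_C,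
    derivative_ofNat, derivative_pow, map_mul, map_neg, map_pow, map_ofNat,
    map_natCast]
  push_cast
  ring

theorem eval_coordinate (a : ℂ) : ∃ w : ℂ, a = ε * (w + 9) := exists_coordinate a

theorem eval_numG (w : ℂ) : numG.eval (ε * (w + 9)) = ε ^ 5 * (w * (w ^ 2 - 75) ^ 2) :=
  aeval_numG w

theorem eval_numH (w : ℂ) : numH.eval (ε * (w + 9)) =
    ε ^ 6 * ((w ^ 2 - 75) * (w ^ 4 - 110 * w ^ 2 + 2025)) := aeval_numH w

theorem eval_polyC (w : ℂ) : polyC.eval (ε * (w + 9)) =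
    -sqrt5⁻¹ * (ε ^ 5 * (w * (w ^ 2 - 81) * (w ^ 2 - 80))) := aeval_polyC w

theorem eval_denG (a : ℂ) : denG.eval a = b₂ * (a * (a - 2 * kappa)) := by
  simp [denG_eq]

theorem eval_denG_ne_zero {a : ℂ} (h0 : a ≠ 0) (hk : a ≠ 2 * kappa) : denG.eval a ≠ 0 := by
  rw [eval_denG]
  exact mul_ne_zero b₂_ne_zero (mul_ne_zero h0 (sub_ne_zero.mpr hk))

theorem eval_denH_ne_zero {a : ℂ} (h0 : a ≠ 0) (hk : a ≠ 2 * kappa) : denH.eval a ≠ 0 := by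
  simpa [denH, d_ne_zero, h0] using sub_ne_zero.mpr hk

theorem eval_polyC_eq_zero_iff (w : ℂ) : polyC.eval (ε * (w + 9)) = 0 ↔
    w = 0 ∨ w ^ 2 = 81 ∨ w ^ 2 = 80 := by
  rw [eval_polyC]
  simp [sqrt5_ne_zero, eps_ne_zero, sub_eq_zero, or_assoc]

theorem eval_derivative_numH (w : ℂ) : numH.derivative.eval (ε * (w + 9)) =
    ε ^ 5 * (w * (6 * w ^ 4 - 740 * w ^ 2 + 20550)) := by
  rw [numH_eq]
  simp [derivative_mul, derivative_pow]
  ring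

theorem eval_derivative_polyC (w : ℂ) : polyC.derivative.eval (ε * (w + 9)) =
    -sqrt5⁻¹ * (ε ^ 4 * (5 * w ^ 4 - 483 * w ^ 2 + 6480)) := by
  rw [polyC, quinticC_eq]
  simp [derivative_mul, derivative_pow]
  exact Or.inl (by ring)

theorem polyC_separable (a : ℂ) (h : polyC.eval a = 0) : polyC.derivative.eval a ≠ 0 := by
  obtain ⟨w, rfl⟩ := eval_coordinate a
  rw [eval_polyC_eq_zero_iff] at h
  rw [eval_derivative_polyC, show w ^ 4 = (w ^ 2) ^ 2 by ring]
  refine mul_ne_zero (by simp [sqrt5_ne_zero]) (mul_ne_zero (pow_ne_zero _ eps_ne_zero) ?_)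
  obtain rfl | h | h := h
  · norm_num
  · rw [h]; norm_num
  · rw [h]; norm_num

theorem numH_eval_ne_zero {a : ℂ} (h : polyC.eval a = 0) : numH.eval a ≠ 0 := by
  obtain ⟨w, rfl⟩ := eval_coordinate a
  rw [eval_polyC_eq_zero_iff] at h
  rw [eval_numH, show w ^ 4 = (w ^ 2) ^ 2 by ring]
  refine mul_ne_zero (pow_ne_zero _ eps_ne_zero) ?_
  obtain rfl | h | h := h
  · norm_num
  · rw [h]; norm_num
  · rw [h]; norm_num

theorem numH_separable {a : ℂ} (h : numH.eval a = 0) : numH.derivative.eval a ≠ 0 := by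
  obtain ⟨w, rfl⟩ := eval_coordinate a
  have hH0 := h
  rw [eval_numH, mul_eq_zero, or_iff_right (pow_ne_zero _ eps_ne_zero), mul_eq_zero,
    show w ^ 4 = (w ^ 2) ^ 2 by ring] at h
  rw [eval_derivative_numH, show w ^ 4 = (w ^ 2) ^ 2 by ring]
  refine mul_ne_zero (pow_ne_zero _ eps_ne_zero) (mul_ne_zero ?_ ?_)
  · rintro rfl
    norm_num at h
  · generalize w ^ 2 = u at h
    obtain h | h := h
    · rw [sub_eq_zero.mp h]
      norm_num
    · intro h'
      -- Eliminating u² between 6u² - 740u + 20550 and u² - 110u + 2025 leaves -80u + 8400 = 0; but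
      -- 105 is not a root of the latter.
      have hu : u = 105 := by linear_combination (h' - 6 * h) / (-80)
      rw [hu] at h
      norm_num at h

theorem numG_eval_ne_zero {a : ℂ} (h : a = 0 ∨ a = 2 * kappa) : numG.eval a ≠ 0 := by
  have hw : ∃ w : ℂ, w ^ 2 = 81 ∧ a = ε * (w + 9) := by
    obtain rfl | rfl := h
    · exact ⟨-9, by norm_num, by ring⟩
    · exact ⟨9, by norm_num, by rw [kappa_eq]; ring⟩
  obtain ⟨w, hw, rfl⟩ := hw
  rw [eval_numG, hw]
  refine mul_ne_zero (pow_ne_zero _ eps_ne_zero) (mul_ne_zero ?_ (by norm_num))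
  rintro rfl
  norm_num at hw

theorem natDegree_numG : numG.natDegree = 5 := by
  unfold numG
  compute_degree!

theorem natDegree_denG : denG.natDegree = 2 := by
  unfold denG
  compute_degree!
  exact b₂_ne_zero

theorem natDegree_numH : numH.natDegree = 6 := by
  unfold numH
  compute_degree!

theorem natDegree_denH : denH.natDegree = 4 := by
  rw [denH, natDegree_mul (by simp [d_ne_zero]) (pow_ne_zero _ (X_sub_C_ne_zero _)), natDegree_pow,
    natDegree_X_sub_C, natDegree_C_mul_X_pow _ _ d_ne_zero]

theorem natDegree_polyC : polyC.natDegree = 2 * 2 + 1 := by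
  rw [polyC, natDegree_C_mul (inv_ne_zero (neg_ne_zero.mpr sqrt5_ne_zero)), natDegree_quinticC]

theorem numG_ne_zero : numG ≠ 0 :=
  ne_zero_of_natDegree_gt (n := 0) (by rw [natDegree_numG]; norm_num)

theorem denG_ne_zero : denG ≠ 0 :=
  ne_zero_of_natDegree_gt (n := 0) (by rw [natDegree_denG]; norm_num)

theorem numH_ne_zero : numH ≠ 0 :=
  ne_zero_of_natDegree_gt (n := 0) (by rw [natDegree_numH]; norm_num)

theorem denH_ne_zero : denH ≠ 0 :=
  ne_zero_of_natDegree_gt (n := 0) (by rw [natDegree_denH]; norm_num)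

theorem isCoprime_numG_denG : IsCoprime numG denG := by
  have hlin : ∀ a : ℂ, numG.eval a ≠ 0 → IsCoprime numG (X - C a) := fun a ha =>
    ((irreducible_X_sub_C a).coprime_iff_not_dvd.mpr (by rwa [dvd_iff_isRoot])).symm
  rw [denG_eq]
  rw [isCoprime_mul_unit_left_right (isUnit_C.mpr (isUnit_iff_ne_zero.mpr b₂_ne_zero))]
  refine IsCoprime.mul_right ?_ (hlin _ (numG_eval_ne_zero (.inr rfl)))
  simpa using hlin 0 (numG_eval_ne_zero (.inl rfl))

/-! ### The two function fields -/

theorem isDoubleCover_C : IsDoubleCover xC yC polyC := by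
  have hs : (-sqrt5) ≠ 0 := neg_ne_zero.mpr sqrt5_ne_zero
  refine isDoubleCover_of_isFractionRing (by rw [natDegree_polyC]; decide) ?_ ?_
  · refine AdjoinRoot.of.injective_of_degree_ne_zero ?_
    rw [polynomialC, degree_sub_C] <;> rw [degree_C_mul_X_pow]
    all_goals simp [sqrt5_ne_zero]
  · have h : AdjoinRoot.mk polynomialC polynomialC = 0 := AdjoinRoot.mk_self
    have hinv : AdjoinRoot.of polynomialC (C (-sqrt5)⁻¹) *
        AdjoinRoot.of polynomialC (C (-sqrt5)) = 1 := by
      rw [← map_mul, ← C_mul, inv_mul_cancel₀ hs, C_1, map_one]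
    rw [polyC, map_mul]
    change AdjoinRoot.of polynomialC (C (-sqrt5)) * AdjoinRoot.root polynomialC ^ 2 -
      AdjoinRoot.of polynomialC quinticC = 0 at h
    linear_combination AdjoinRoot.of polynomialC (C (-sqrt5)⁻¹) * h -
      AdjoinRoot.root polynomialC ^ 2 * hinv

theorem polynomialE : curveE.polynomial = X ^ 2 - C (X ^ 3 - X) := by
  rw [WeierstrassCurve.Affine.polynomial]
  simp [curveE]
  ring

theorem root_sq_polynomialE : AdjoinRoot.root curveE.polynomial ^ 2 =
    AdjoinRoot.of curveE.polynomial (X ^ 3 - X) := by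
  have h : AdjoinRoot.mk curveE.polynomial (X ^ 2 - C (X ^ 3 - X)) = 0 := by
    rw [← polynomialE, AdjoinRoot.mk_self]
  rw [map_sub, map_pow, sub_eq_zero] at h
  exact h

theorem natDegree_polyE : (X ^ 3 - X : ℂ[X]).natDegree = 2 * 1 + 1 := by compute_degree!

theorem isDoubleCover_E : IsDoubleCover xE yE (X ^ 3 - X : ℂ[X]) := by
  refine isDoubleCover_of_isFractionRing (by rw [natDegree_polyE]; decide)
    (AdjoinRoot.of.injective_of_degree_ne_zero ?_) root_sq_polynomialE
  rw [polynomialE, degree_X_pow_sub_C two_pos]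
  decide

theorem isElliptic_curveE : curveE.IsElliptic := by
  rw [WeierstrassCurve.isElliptic_iff]
  rw [show curveE.Δ = 64 by
    simp [curveE, WeierstrassCurve.Δ, WeierstrassCurve.b₂, WeierstrassCurve.b₄,
      WeierstrassCurve.b₆, WeierstrassCurve.b₈]
    norm_num]
  simp

/-- An element algebraic over ℂ is a constant, which would make `numG`, of degree 5, a multiple of
`denG`, of degree 2. -/
theorem transcendental_coverG : Transcendental ℂ (coverG xC) := by
  intro halg
  have hC := isDoubleCover_C
  have hden : aeval xC denG ≠ 0 := hC.aeval_ne_zero denG_ne_zero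
  obtain ⟨c, hc⟩ : ∃ c : ℂ, algebraMap ℂ FunctionFieldC c = coverG xC :=
    minpoly.mem_range_of_degree_eq_one ℂ _ (IsAlgClosed.degree_eq_one_of_irreducible ℂ
      (minpoly.irreducible halg.isIntegral))
  have h0 : aeval xC (numG - C c * denG) = 0 := by
    rw [coverG_eq, eq_div_iff hden] at hc
    rw [map_sub, map_mul, aeval_C, hc, sub_self]
  have h1 : numG = C c * denG := sub_eq_zero.mp (by_contra fun h => hC.aeval_ne_zero h h0)
  have h2 := (natDegree_C_mul_le c denG)
  rw [← h1, natDegree_numG, natDegree_denG] at h2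
  omega

/-- The pullback of functions along the cover. -/
theorem exists_pullback : ∃ φ : curveE.FunctionField →ₐ[ℂ] FunctionFieldC,
    φ xE = coverG xC ∧ φ yE = coverH xC * yC := by
  have hC := isDoubleCover_C
  have hE := isDoubleCover_E
  have hden : aeval xC denG ≠ 0 := hC.aeval_ne_zero denG_ne_zero
  have hsq : (coverH xC * yC) ^ 2 = aeval (coverG xC) (X ^ 3 - X : ℂ[X]) := by
    rw [mul_pow, hC.sq_eq, coverH_sq_mul hden]
    simp
  let i : ℂ[X] →+* FunctionFieldC := (aeval (R := ℂ) (coverG xC)).toRingHom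
  let ψ : curveE.CoordinateRing →+* FunctionFieldC :=
    AdjoinRoot.lift i (coverH xC * yC) (by
      rw [polynomialE, eval₂_sub, eval₂_C, eval₂_pow, eval₂_X, hsq]
      exact sub_self _)
  have hψ : ∀ p, ψ (AdjoinRoot.of _ p) = aeval (coverG xC) p := fun p => AdjoinRoot.lift_of _
  have hψ' : ψ (AdjoinRoot.root _) = coverH xC * yC := AdjoinRoot.lift_root _
  have hroot : AdjoinRoot.root curveE.polynomial ^ 2 =
      AdjoinRoot.of curveE.polynomial (X ^ 3 - X) := root_sq_polynomialE
  -- A kernel element p + qy has norm p² - q²(X³ - X) killed by substituting the transcendental g,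
  -- so the norm vanishes and p = q = 0.
  have hinj : Function.Injective ψ := by
    rw [injective_iff_map_eq_zero]
    intro r hr
    obtain ⟨p, q, rfl⟩ := AdjoinRoot.exists_eq_of_add_of_mul_root hroot r
    rw [map_add, map_mul, hψ, hψ, hψ'] at hr
    have h0 : aeval (coverG xC) (p ^ 2 - q ^ 2 * (X ^ 3 - X)) = 0 := by
      rw [map_sub, map_mul, map_pow, map_pow, ← hsq]
      linear_combination (aeval (coverG xC) p - aeval (coverG xC) q * (coverH xC * yC)) * hr
    obtain ⟨rfl, rfl⟩ := hE.norm_eq_zero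
      (by_contra fun h => transcendental_coverG ⟨_, h, h0⟩)
    simp
  let ψ' : curveE.CoordinateRing →ₐ[ℂ] FunctionFieldC :=
    { ψ with
      commutes' := fun c => by
        change ψ (AdjoinRoot.of _ (C c)) = _
        rw [hψ, aeval_C] }
  have hlift : ∀ r, IsFractionRing.liftAlgHom (K := curveE.FunctionField) (g := ψ') hinj
      (algebraMap _ _ r) = ψ r := fun r => IsFractionRing.lift_algebraMap hinj r
  refine ⟨IsFractionRing.liftAlgHom (g := ψ') hinj, ?_, ?_⟩
  · rw [xE, hlift, hψ, aeval_X]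
  · rw [yE, hlift, hψ']

/-- Compute the degree over ℂ(g) in two ways: through ℂ(x) it is 5 · 2, through the image of the
function field of E it is 2 times the degree sought. -/
theorem finrank_fieldRange {φ : curveE.FunctionField →ₐ[ℂ] FunctionFieldC}
    (hφ : φ xE = coverG xC) : Module.finrank φ.fieldRange FunctionFieldC = 5 := by
  have hC := isDoubleCover_C
  let N := IntermediateField.adjoin ℂ {coverG xC}
  have hN : N = (IntermediateField.adjoin ℂ {xE}).map φ := by
    rw [IntermediateField.adjoin_map, Set.image_singleton, hφ]
  have hF : φ.fieldRange = (⊤ : IntermediateField ℂ curveE.FunctionField).map φ :=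
    AlgHom.fieldRange_eq_map φ
  have h1 : IntermediateField.relfinrank N φ.fieldRange = 2 := by
    rw [hN, hF, IntermediateField.relfinrank_map_map, IntermediateField.relfinrank_top_right,
      isDoubleCover_E.finrank_adjoin]
  have h2 : IntermediateField.relfinrank N (IntermediateField.adjoin ℂ {xC}) = 5 := by
    have := relfinrank_adjoin_div hC.transcendental isCoprime_numG_denG
      (by rw [natDegree_numG, natDegree_denG]; norm_num)
    rwa [natDegree_numG] at this
  have h3 := IntermediateField.relfinrank_mul_finrank_top (A := N) (B := φ.fieldRange) (by
    rw [IntermediateField.adjoin_simple_le_iff, ← hφ]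
    exact ⟨xE, rfl⟩)
  have h4 := IntermediateField.relfinrank_mul_finrank_top (A := N)
    (B := IntermediateField.adjoin ℂ {xC}) (by
      have hmem : ∀ p : ℂ[X], aeval xC p ∈ IntermediateField.adjoin ℂ {xC} := fun p =>
        IntermediateField.algebra_adjoin_le_adjoin _ _ (aeval_mem_adjoin_singleton _ _)
      rw [IntermediateField.adjoin_simple_le_iff, coverG_eq]
      exact div_mem (hmem _) (hmem _))
  rw [h2, hC.finrank_adjoin] at h4
  rw [h1] at h3
  omega

theorem finite_of_pullback {φ : curveE.FunctionField →ₐ[ℂ] FunctionFieldC}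
    (hφ : φ xE = coverG xC) : φ.toRingHom.Finite := by
  have : Module.Finite φ.fieldRange FunctionFieldC :=
    Module.finite_of_finrank_pos (by rw [finrank_fieldRange hφ]; norm_num)
  have h1 : (algebraMap φ.fieldRange FunctionFieldC).Finite := RingHom.finite_algebraMap.mpr this
  exact h1.comp (RingHom.Finite.of_surjective φ.rangeRestrict.toRingHom
    φ.rangeRestrict_surjective)

end Cover

/-! ### Values and ramification of the cover -/

theorem CurvePoint.HasValue.valuation_aeval_of_simple_root {k K : Type*} [Field k] [Field K]
    [Algebra k K] {P : CurvePoint k K} {x : K} {a : k} (hx : P.HasValue x a) {p : k[X]}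
    (h0 : p.eval a = 0) (h1 : p.derivative.eval a ≠ 0) :
    P.ring.valuation (Polynomial.aeval x p) = P.ring.valuation (x - algebraMap k K a) := by
  obtain ⟨q, rfl⟩ := dvd_iff_isRoot.mpr h0
  have hq : q.eval a ≠ 0 := by simpa [derivative_mul] using h1
  rw [map_mul, map_mul, (hx.aeval q).valuation_eq_one hq, mul_one]
  simp

namespace Cover

open CoverCoeff IsDoubleCover

theorem eval_polyC_eq {a b : ℂ} : -sqrt5 * b ^ 2 =
    a * (a - 1) * (a - kappa) * (a - 2 * kappa + 1) * (a - 2 * kappa) ↔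
      b ^ 2 = polyC.eval a := by
  have hs := sqrt5_ne_zero
  have : polyC.eval a = (-sqrt5)⁻¹ *
      (a * (a - 1) * (a - kappa) * (a - 2 * kappa + 1) * (a - 2 * kappa)) := by
    simp only [polyC, quinticC, eval_mul, eval_sub, eval_X, eval_C]
    ring
  rw [this, eq_inv_mul_iff_mul_eq₀ (neg_ne_zero.mpr hs)]

theorem eval_polyC_of_special {a : ℂ} (h : a = 0 ∨ a = 2 * kappa) : polyC.eval a = 0 := by
  obtain rfl | rfl := h <;> simp [polyC, quinticC]

variable {P : CurvePoint ℂ FunctionFieldC} {a b : ℂ}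

theorem hasValue_coverG (ha : P.HasValue xC a) (h0 : a ≠ 0) (hk : a ≠ 2 * kappa) :
    P.HasValue (coverG xC) (coverG a) :=
  (ha.aeval numG).div (ha.aeval denG) (eval_denG_ne_zero h0 hk)

theorem hasValue_coverH (ha : P.HasValue xC a) (h0 : a ≠ 0) (hk : a ≠ 2 * kappa) :
    P.HasValue (coverH xC) (coverH a) :=
  (ha.aeval numH).div (ha.aeval denH) (eval_denH_ne_zero h0 hk)

theorem equation_cover (hab : b ^ 2 = polyC.eval a) (h0 : a ≠ 0) (hk : a ≠ 2 * kappa) :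
    curveE.Equation (coverG a) (coverH a * b) := by
  rw [WeierstrassCurve.Affine.equation_iff]
  have h := coverH_sq_mul (K := ℂ) (x := a) (eval_denG_ne_zero h0 hk)
  rw [coe_aeval_eq_eval, ← hab] at h
  simp only [curveE]
  linear_combination h

theorem valuation_coverG_of_hasPole (hP : P.HasPole xC) :
    P.ring.valuation (coverG xC) = P.ring.valuation (xC ^ 2 / yC) ^ (-6 : ℤ) := by
  have hC := isDoubleCover_C
  have hT : P.ring.valuation (xC ^ 2 / yC) ≠ 0 := by simpa using hC.param_ne_zero 2
  rw [coverG_eq, map_div₀, hC.valuation_aeval_eq hP natDegree_polyC numG_ne_zero,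
    hC.valuation_aeval_eq hP natDegree_polyC denG_ne_zero, ← zpow_sub₀ hT, natDegree_numG,
    natDegree_denG]
  norm_num

theorem valuation_coverH_of_hasPole (hP : P.HasPole xC) :
    P.ring.valuation (coverH xC) = P.ring.valuation (xC ^ 2 / yC) ^ (-4 : ℤ) := by
  have hC := isDoubleCover_C
  have hT : P.ring.valuation (xC ^ 2 / yC) ≠ 0 := by simpa using hC.param_ne_zero 2
  rw [coverH_eq, map_div₀, hC.valuation_aeval_eq hP natDegree_polyC numH_ne_zero,
    hC.valuation_aeval_eq hP natDegree_polyC denH_ne_zero, ← zpow_sub₀ hT, natDegree_numH,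
    natDegree_denH]
  norm_num

theorem hasPole_coverG (hP : P.HasPole xC) : P.HasPole (coverG xC) := by
  rw [CurvePoint.hasPole_iff, valuation_coverG_of_hasPole hP]
  exact one_lt_zpow_of_neg₀ (zero_lt_iff.mpr (by simpa using isDoubleCover_C.param_ne_zero 2))
    (isDoubleCover_C.valuation_param_lt_one hP natDegree_polyC) (by norm_num)

variable {f : CurveMorphism ℂ FunctionFieldC curveE.FunctionField}

/-- The local parameter x_E / y_E pulls back to order -6 - (-4 - 5) = 3. -/
theorem ramificationIndex_of_hasPole (hx : f.pullback xE = coverG xC)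
    (hy : f.pullback yE = coverH xC * yC) (hP : P.HasPole xC) : f.ramificationIndex P = 3 := by
  have hC := isDoubleCover_C
  have hT : P.ring.valuation (xC ^ 2 / yC) ≠ 0 := by simpa using hC.param_ne_zero 2
  have hmap : (f.map P).HasPole xE := by
    rw [CurveMorphism.map_hasPole_iff, hx]
    exact hasPole_coverG hP
  refine f.ramificationIndex_eq_of_isUniformizer (hC.isUniformizer_param natDegree_polyC hP)
    (isDoubleCover_E.isUniformizer_param natDegree_polyE hmap) ?_
  rw [pow_one, map_div₀, hx, hy, map_div₀, map_mul, valuation_coverG_of_hasPole hP,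
    valuation_coverH_of_hasPole hP, hC.valuation_y_eq hP natDegree_polyC, ← zpow_add₀ hT,
    ← zpow_sub₀ hT, ← zpow_natCast]
  norm_num

theorem isUniformizer_yC (ha : P.HasValue xC a) (hb : P.HasValue yC 0) : P.IsUniformizer yC := by
  simpa [localParam] using isDoubleCover_C.isUniformizer_localParam polyC_separable ha hb

theorem isUniformizer_xC_sub (ha : P.HasValue xC a) (hb : P.HasValue yC b) (hb0 : b ≠ 0) :
    P.IsUniformizer (xC - algebraMap ℂ _ a) := by
  simpa [localParam, hb0] using isDoubleCover_C.isUniformizer_localParam polyC_separable ha hb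

/-- These points lie above infinity on E. Writing y² = x(x - 2κ)R gives g/(hy) = (d/b₂) · numG/(numH
· R) · y, a unit times the local parameter y. -/
theorem ramificationIndex_of_special (hx : f.pullback xE = coverG xC)
    (hy : f.pullback yE = coverH xC * yC) (ha : P.HasValue xC a) (hb : P.HasValue yC b)
    (hs : a = 0 ∨ a = 2 * kappa) : f.ramificationIndex P = 1 := by
  have hC := isDoubleCover_C
  have hQa := eval_polyC_of_special hs
  have hb0 : b = 0 := by
    have := hC.sq_eq_of_hasValue ha hb
    rw [hQa] at this
    simpa using this
  subst hb0
  obtain ⟨R, hR⟩ : ∃ R : ℂ[X], polyC = X * (X - C (2 * kappa)) * R :=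
    ⟨C (-sqrt5)⁻¹ * ((X - C 1) * (X - C kappa) * (X - C (2 * kappa - 1))), by
      rw [polyC, quinticC]; ring⟩
  have hRa : R.eval a ≠ 0 := by
    intro h0
    refine polyC_separable a hQa ?_
    rw [hR, derivative_mul, eval_add, eval_mul, eval_mul, h0]
    obtain rfl | rfl := hs <;> simp
  refine f.ramificationIndex_eq_one (isUniformizer_yC ha hb) (s := xE / yE) ?_
  have hG := (ha.aeval numG).valuation_eq_one (numG_eval_ne_zero hs)
  have hH := (ha.aeval numH).valuation_eq_one (numH_eval_ne_zero hQa)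
  have hR1 := (ha.aeval R).valuation_eq_one hRa
  have hne : ∀ {p : ℂ[X]}, p ≠ 0 → aeval xC p ≠ 0 := hC.aeval_ne_zero
  have hR0 : R ≠ 0 := by rintro rfl; simp at hRa
  have hyne := hC.y_ne_zero
  have hkey : f.pullback (xE / yE) * (aeval xC numH * aeval xC R * algebraMap ℂ _ b₂) =
      aeval xC numG * algebraMap ℂ _ d * yC := by
    have hysq : yC ^ 2 = xC * (xC - algebraMap ℂ _ (2 * kappa)) * aeval xC R := by
      rw [hC.sq_eq, hR]
      simp only [map_mul, map_sub, aeval_X, aeval_C]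
    have hX0 : xC ≠ 0 := by simpa using hne X_ne_zero
    have hK0 : xC - algebraMap ℂ _ (2 * kappa) ≠ 0 := by
      simpa only [map_sub, aeval_X, aeval_C] using hne (X_sub_C_ne_zero (2 * kappa))
    have hb0 : algebraMap ℂ FunctionFieldC b₂ ≠ 0 := by simpa using b₂_ne_zero
    have hd0 : algebraMap ℂ FunctionFieldC d ≠ 0 := by simpa using d_ne_zero
    have hdG : aeval xC denG = algebraMap ℂ FunctionFieldC b₂ *
        (xC * (xC - algebraMap ℂ _ (2 * kappa))) := by
      rw [denG_eq]
      simp only [map_mul, map_sub, aeval_X, aeval_C]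
    have hdH : aeval xC denH = algebraMap ℂ FunctionFieldC d * xC ^ 2 *
        (xC - algebraMap ℂ _ (2 * kappa)) ^ 2 := by
      rw [denH]
      simp only [map_mul, map_sub, map_pow, aeval_X, aeval_C]
    have hH0 := hne numH_ne_zero
    rw [map_div₀, hx, hy, coverG_eq, coverH_eq, hdG, hdH]
    generalize xC - algebraMap ℂ FunctionFieldC (2 * kappa) = u at *
    generalize aeval xC numH = N at *
    generalize aeval xC numG = M at *
    field_simp
    rw [hysq]
    ring
  have hv := congrArg P.ring.valuation hkey
  simp only [map_mul, hG, hH, hR1, P.valuation_algebraMap b₂_ne_zero,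
    P.valuation_algebraMap d_ne_zero, mul_one, one_mul] at hv
  exact hv

/-- Where hy vanishes, exactly one of h and y does and its zero is simple, so y_E pulls back to a
local parameter. Where it does not, g'(a) ≠ 0 and x_E - g(a) serves. -/
theorem ramificationIndex_of_finite (hx : f.pullback xE = coverG xC)
    (hy : f.pullback yE = coverH xC * yC) (ha : P.HasValue xC a) (hb : P.HasValue yC b)
    (h0 : a ≠ 0) (hk : a ≠ 2 * kappa) : f.ramificationIndex P = 1 := by
  have hab := isDoubleCover_C.sq_eq_of_hasValue ha hb
  have hDG := eval_denG_ne_zero h0 hk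
  have hDH := (ha.aeval denH).valuation_eq_one (eval_denH_ne_zero h0 hk)
  have hyE : P.ring.valuation (f.pullback yE) =
      P.ring.valuation (aeval xC numH) * P.ring.valuation yC := by
    rw [hy, coverH_eq, map_mul, map_div₀, hDH, div_one]
  by_cases hb0 : b = 0
  · subst hb0
    have hQa : polyC.eval a = 0 := by simpa using hab.symm
    refine f.ramificationIndex_eq_one (isUniformizer_yC ha hb) (s := yE) ?_
    rw [hyE, (ha.aeval numH).valuation_eq_one (numH_eval_ne_zero hQa), one_mul]
  by_cases hH : numH.eval a = 0
  · refine f.ramificationIndex_eq_one (isUniformizer_xC_sub ha hb hb0) (s := yE) ?_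
    rw [hyE, hb.valuation_eq_one hb0, mul_one,
      ha.valuation_aeval_of_simple_root hH (numH_separable hH)]
  · refine f.ramificationIndex_eq_one (isUniformizer_xC_sub ha hb hb0)
      (s := xE - algebraMap ℂ _ (coverG a)) ?_
    have hG : coverG a = numG.eval a / denG.eval a := by
      rw [coverG_eq, coe_aeval_eq_eval]
    have hD := ha.aeval denG
    have hD0 : aeval xC denG ≠ 0 := isDoubleCover_C.aeval_ne_zero denG_ne_zero
    have hpoly : f.pullback (xE - algebraMap ℂ _ (coverG a)) * aeval xC denG =
        aeval xC (numG - C (coverG a) * denG) := by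
      rw [map_sub, hx, f.pullback.commutes, coverG_eq, sub_mul, div_mul_cancel₀ _ hD0, map_sub,
        map_mul, aeval_C]
    have hv := congrArg P.ring.valuation hpoly
    rw [map_mul, hD.valuation_eq_one hDG, mul_one] at hv
    rw [hv]
    refine ha.valuation_aeval_of_simple_root ?_ ?_
    · rw [eval_sub, eval_mul, eval_C, hG, div_mul_cancel₀ _ hDG, sub_self]
    -- The derivative of numG - g(a) denG at a, times denG(a), is the numerator of g' at a, a
    -- nonzero multiple of numH(a).
    · have hder := congrArg (eval a) derivative_mul_sub
      rw [eval_sub, eval_mul, eval_mul, eval_mul, eval_C] at hder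
      have hne : -300 * sqrt5 * ε ^ 3 * numH.eval a ≠ 0 :=
        mul_ne_zero (mul_ne_zero (mul_ne_zero (by norm_num) sqrt5_ne_zero)
          (pow_ne_zero _ eps_ne_zero)) hH
      rw [← hder] at hne
      intro h
      apply hne
      rw [derivative_sub, derivative_C_mul, eval_sub, eval_mul, eval_C, hG] at h
      field_simp at h
      linear_combination h

end Cover

open Cover in
/-- The smooth projective curve `C : -√5 y² = x (x - 1) (x - κ) (x - 2κ + 1) (x - 2κ)`, whose points
are those of the affine curve and one point `∞`, has genus two, and `f (x, y) = (g x, h x * y)`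
is a morphism of degree five from `C` to the elliptic curve `E : y² = x³ - x` which maps the
point at infinity of `C` to that of `E` with ramification index three and is unramified at every
other point of `C`. -/
theorem theorem2p1 :
    (∀ a b : ℂ, -sqrt5 * b ^ 2 =
        a * (a - 1) * (a - kappa) * (a - 2 * kappa + 1) * (a - 2 * kappa) →
      ∃! P : CurvePoint ℂ FunctionFieldC, P.HasValue xC a ∧ P.HasValue yC b) ∧
    curveGenus ℂ FunctionFieldC = 2 ∧
    curveE.IsElliptic ∧
    ∃ (inftyC : CurvePoint ℂ FunctionFieldC) (inftyE : CurvePoint ℂ curveE.FunctionField)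
      (f : CurveMorphism ℂ FunctionFieldC curveE.FunctionField),
      (∀ P : CurvePoint ℂ FunctionFieldC, P.HasPole xC ↔ P = inftyC) ∧
      (∀ Q : CurvePoint ℂ curveE.FunctionField, Q.HasPole xE ↔ Q = inftyE) ∧
      f.pullback xE = coverG xC ∧
      f.pullback yE = coverH xC * yC ∧
      (∀ (P : CurvePoint ℂ FunctionFieldC) (a b : ℂ), P.HasValue xC a → P.HasValue yC b →
        a ≠ 0 → a ≠ 2 * kappa →
          curveE.Equation (coverG a) (coverH a * b) ∧
          (f.map P).HasValue xE (coverG a) ∧ (f.map P).HasValue yE (coverH a * b)) ∧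
      f.degree = 5 ∧
      f.map inftyC = inftyE ∧
      f.ramificationIndex inftyC = 3 ∧
      ∀ P : CurvePoint ℂ FunctionFieldC, P ≠ inftyC → f.ramificationIndex P = 1 := by
  have hC := isDoubleCover_C
  obtain ⟨φ, hx, hy⟩ := exists_pullback
  let f : CurveMorphism ℂ FunctionFieldC curveE.FunctionField := ⟨φ, finite_of_pullback hx⟩
  obtain ⟨inftyC, hinftyC, hC'⟩ := hC.existsUnique_hasPole
  obtain ⟨inftyE, hinftyE, hE'⟩ := isDoubleCover_E.existsUnique_hasPole
  refine ⟨fun a b hab => hC.existsUnique_hasValue polyC_separable (eval_polyC_eq.mp hab),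
    hC.curveGenus_eq polyC_separable natDegree_polyC, isElliptic_curveE, inftyC, inftyE, f,
    fun P => ⟨fun h => hC' P h, fun h => h ▸ hinftyC⟩,
    fun P => ⟨fun h => hE' P h, fun h => h ▸ hinftyE⟩, hx, hy, fun P a b ha hb h0 hk => ?_,
    finrank_fieldRange hx, ?_, ramificationIndex_of_hasPole hx hy hinftyC, fun P hP => ?_⟩
  · refine ⟨equation_cover (hC.sq_eq_of_hasValue ha hb) h0 hk, ?_, ?_⟩
    · rw [CurveMorphism.map_hasValue_iff]
      change P.HasValue (φ xE) _
      rw [hx]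
      exact hasValue_coverG ha h0 hk
    · rw [CurveMorphism.map_hasValue_iff]
      change P.HasValue (φ yE) _
      rw [hy]
      exact (hasValue_coverH ha h0 hk).mul hb
  · refine hE' (f.map inftyC) (CurveMorphism.map_hasPole_iff f |>.mpr ?_)
    change inftyC.HasPole (φ xE)
    rw [hx]
    exact hasPole_coverG hinftyC
  · obtain hpole | ⟨a, b, ha, hb⟩ := hC.hasValue_or_hasPole P
    · exact absurd (hC' P hpole) hP
    by_cases hs : a = 0 ∨ a = 2 * kappa
    · exact ramificationIndex_of_special hx hy ha hb hs
    · rw [not_or] at hs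
      exact ramificationIndex_of_finite hx hy ha hb hs.1 hs.2
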